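/- Let $p$ be a prime, $q=p$ if $p$ is odd and $q=4$ if $p=2$, and let $\omega$ be the Teichmüller character, i.e. the $\mathbb{C}_p$-valued Dirichlet character modulo $q$ with $\omega(a)\equiv a \pmod q$ for $p\nmid a$. For an integer $a$ prime to $p$ put $\langle a\rangle=\omega(a)^{-1}a$, and for $s\in\mathbb{C}_p$ with $|s|<qp^{-1/(p-1)}$ put $\langle a\rangle^s=\sum_{j\ge 0}\binom{s}{j}(\langle a\rangle-1)^j$. A product such as $\chi\omega^{-n}$ denotes the associated primitive Dirichlet character. Let $\chi$ be an even $\mathbb{C}_p$-valued primitive Dirichlet character of conductor $f$, and let $L_p(s,\chi)$ be its (Kubota--Leopoldt) $p$-adic $L$-function: the unique meromorphic function on the disc $\{s\in\mathbb{C}_p : |s|<qp^{-1/(p-1)}\}$, analytic if $\chi\ne 1$ and with at most a simple pole at $s=1$ as its only singularity if $\chi=1$, such that for all integers $n\ge 1$ $$L_p(1-n,\chi)=-\bigl(1-\chi\omega^{-n}(p)\,p^{n-1}\bigr)\frac{B_{n,\chi\omega^{-n}}}{n},$$ where $B_{n,\psi}=N^{n-1}\sum_{a=1}^{N}\psi(a)B_n(a/N)$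 is the generalized Bernoulli number of a character $\psi$ of conductor $N$. Let $c>1$ be an integer with $(c,pf)=1$. For an integer $a$ and a positive integer $F$ prime to $c$ put $$\epsilon_{a,c,F}=\frac{c-1}{2}-\{-aF^{-1}\}_c ,$$ where $F^{-1}$ is the inverse of $F$ modulo $c$ and $\{x\}_c\in\{0,1,\dots,c-1\}$ is the representative of $x$ modulo $c$. Then for all $s\in\mathbb{C}_p$ with $|s|<qp^{-1/(p-1)}$, $$-(1-\chi(c)\langle c\rangle^{1-s})\,L_p(s,\chi)=\lim_{n\to\infty}\ \sum_{\substack{a=1\\ p\,\nmid\, a}}^{fp^n}\chi\omega^{-1}(a)\,\frac{\epsilon_{a,c,fp^n}}{\langle a\rangle^{s}} .$$ If $\chi=1$ and $s=1$ (the pole of $L_p(s,1)$), the left side is understood as its limit as $s\to 1$, $s\neq 1$, which exists. -/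

import Mathlib

open Filter Topology

/-- The integer `q`: `q = p` if `p` is odd, and `q = 4` if `p = 2`. -/
def padicQ (p : ℕ) : ℕ := if p = 2 then 4 else p

/-- The radius `q * p ^ (-1 / (p - 1))`. -/
noncomputable def padicLRadius (p : ℕ) : ℝ :=
  (padicQ p : ℝ) * (p : ℝ) ^ (-1 / ((p : ℝ) - 1))

/-- Existence of the Teichmüller character. -/
theorem exists_teichmullerCharacter (p : ℕ) [hp : Fact p.Prime] :
    ∃ ω : DirichletCharacter ℂ_[p] (padicQ p),
      ∀ a : ℕ, ¬ p ∣ a → ‖ω (a : ZMod (padicQ p)) - (a : ℂ_[p])‖ ≤ ((padicQ p : ℕ) : ℝ)⁻¹ := by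
  by_cases h2 : p = 2
  · subst h2
    have key : ∃ ω : DirichletCharacter ℂ_[2] 4,
        ∀ a : ℕ, ¬ 2 ∣ a → ‖ω (a : ZMod 4) - (a : ℂ_[2])‖ ≤ ((4 : ℕ) : ℝ)⁻¹ := by
      refine ⟨ZMod.χ₄.ringHomComp (Int.castRingHom ℂ_[2]), fun a ha => ?_⟩
      have h4 : ((2 : ℤ) ^ 2) ∣ (ZMod.χ₄ (a : ZMod 4) - a) := by
        rw [ZMod.χ₄_nat_mod_four]
        have h : a % 4 = 1 ∨ a % 4 = 3 := by omega
        rcases h with h | h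
        · rw [h, show ZMod.χ₄ ((1 : ℕ) : ZMod 4) = 1 from rfl]; omega
        · rw [h, show ZMod.χ₄ ((3 : ℕ) : ZMod 4) = -1 from rfl]; omega
      have hn := (Padic.norm_int_le_pow_iff_dvd (p := 2) (ZMod.χ₄ (a : ZMod 4) - a) 2).2
        (by exact_mod_cast h4)
      rw [← PadicComplex.norm_extends'] at hn
      have e : (((((ZMod.χ₄ (a : ZMod 4) - a : ℤ) : ℚ_[2])) : PadicAlgCl 2) : ℂ_[2])
          = ((ZMod.χ₄ (a : ZMod 4) : ℤ) : ℂ_[2]) - (a : ℂ_[2]) := by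
        rw [PadicComplex.coe_eq]; push_cast; simp
      rw [e] at hn
      refine le_trans hn ?_
      norm_num
    exact key
  · have hq : padicQ p = p := if_neg h2
    generalize padicQ p = q at hq
    subst hq
    let φ : ℤ_[q] →+* ℂ_[q] := (algebraMap ℚ_[q] ℂ_[q]).comp PadicInt.Coe.ringHom
    let τ : ZMod q →* ℤ_[q] :=
      (WittVector.toPadicInt q).toMonoidHom.comp (WittVector.teichmuller q)
    refine ⟨{ toMonoidHom := φ.toMonoidHom.comp τ, map_nonunit' := fun x hx => ?_ },
      fun a _ => ?_⟩
    · have : x = 0 := by simpa using hx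
      subst this
      simp [τ]
    · have hdvd : (q : ℤ_[q]) ∣ τ a - (a : ℤ_[q]) := by
        have h0 : (WittVector.teichmuller q (a : ZMod q) - (a : WittVector q (ZMod q)))
            ∈ Ideal.span {(q : WittVector q (ZMod q))} := by
          rw [WittVector.mem_span_p_iff_coeff_zero_eq_zero]
          rw [← WittVector.constantCoeff_apply]
          rw [map_sub, map_natCast WittVector.constantCoeff, WittVector.constantCoeff_apply,
            WittVector.teichmuller_coeff_zero, sub_self]
        have h1 := map_dvd (WittVector.toPadicInt q) (Ideal.mem_span_singleton.1 h0)
        simpa [τ] using h1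
      have hn : ‖τ a - (a : ℤ_[q])‖ ≤ (q : ℝ)⁻¹ := by
        have := (PadicInt.norm_le_pow_iff_mem_span_pow (τ a - (a : ℤ_[q])) 1).2
          (by simpa [Ideal.mem_span_singleton] using hdvd)
        simpa using this
      have e : φ (τ a - (a : ℤ_[q])) = φ (τ a) - (a : ℂ_[q]) := by simp
      change ‖φ (τ a) - (a : ℂ_[q])‖ ≤ _
      rw [← e]
      refine le_trans (le_of_eq ?_) hn
      change ‖algebraMap ℚ_[q] ℂ_[q] ((τ a - (a : ℤ_[q]) : ℤ_[q]) : ℚ_[q])‖ = _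
      rw [norm_algebraMap', PadicInt.norm_def]

/-- The Teichmüller character `ω`, a Dirichlet character modulo `q` with values in `ℂ_p`:
`ω(a) ≡ a` modulo `q` for every `a` prime to `p`. This congruence determines `ω`, because
distinct `φ(q)`-th roots of unity of `ℂ_p` are not congruent modulo `q`. -/
noncomputable def teichmullerCharacter (p : ℕ) [Fact p.Prime] :
    DirichletCharacter ℂ_[p] (padicQ p) :=
  Classical.choose (exists_teichmullerCharacter p)

/-- `⟨a⟩ = a / ω(a)`, for `a` prime to `p`. -/
noncomputable def angleBracket (p : ℕ) [Fact p.Prime] (a : ℕ) : ℂ_[p] :=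
  (a : ℂ_[p]) / teichmullerCharacter p (a : ZMod (padicQ p))

/-- The `p`-adic power `x ^ s = ∑_{j ≥ 0} binom(s, j) (x - 1) ^ j`. The series converges
if `|x - 1| ≤ 1 / q` and `|s| < q * p ^ (-1 / (p - 1))`. -/
noncomputable def padicPow (p : ℕ) [Fact p.Prime] (x s : ℂ_[p]) : ℂ_[p] :=
  ∑' j : ℕ, Ring.choose s j * (x - 1) ^ j

/-- The primitive Dirichlet character `χ ω ^ (-n)`. -/
noncomputable def teichmullerTwist (p : ℕ) [Fact p.Prime] {f : ℕ}
    (χ : DirichletCharacter ℂ_[p] f) (n : ℕ) :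
    DirichletCharacter ℂ_[p] (χ.mul ((teichmullerCharacter p)⁻¹ ^ n)).conductor :=
  χ.primitive_mul ((teichmullerCharacter p)⁻¹ ^ n)

/-- The generalized Bernoulli number `B_{n,ψ} = N ^ (n - 1) * ∑_{a = 1}^N ψ(a) B_n(a / N)` of a
Dirichlet character `ψ` modulo `N`. -/
noncomputable def generalizedBernoulli (p : ℕ) [Fact p.Prime] {N : ℕ}
    (ψ : DirichletCharacter ℂ_[p] N) (n : ℕ) : ℂ_[p] :=
  (N : ℂ_[p]) ^ ((n : ℤ) - 1) * ∑ a ∈ Finset.Icc 1 N,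
    ψ (a : ZMod N) * ((((Polynomial.bernoulli n).eval ((a : ℚ) / (N : ℚ)) : ℚ)) : ℂ_[p])

/-- `g` is given on the open disc `|s| < r` of `ℂ_p` by a single power series that converges
on this disc. -/
def IsAnalyticOnDisc (p : ℕ) [Fact p.Prime] (r : ℝ) (g : ℂ_[p] → ℂ_[p]) : Prop :=
  ∃ b : ℕ → ℂ_[p], ∀ s : ℂ_[p], ‖s‖ < r → HasSum (fun k : ℕ => b k * s ^ k) (g s)

/-- `L` is a Kubota-Leopoldt `p`-adic `L`-function of `χ`: a meromorphic function on the disc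
`|s| < q * p ^ (-1 / (p - 1))` with at most a simple pole, at `s = 1`, that is analytic on the
whole disc if `χ ≠ 1`, and such that, for all integers `n ≥ 1`,
`L(1 - n) = -(1 - χω⁻ⁿ(p) p ^ (n - 1)) * B_{n, χω⁻ⁿ} / n`. -/
structure IsPadicLFunction (p : ℕ) [Fact p.Prime] {f : ℕ}
    (χ : DirichletCharacter ℂ_[p] f) (L : ℂ_[p] → ℂ_[p]) : Prop where
  meromorphic : ∃ g : ℂ_[p] → ℂ_[p], IsAnalyticOnDisc p (padicLRadius p) g ∧
    ∀ s : ℂ_[p], ‖s‖ < padicLRadius p → s ≠ 1 → L s = g s / (s - 1)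
  analytic : χ ≠ 1 → IsAnalyticOnDisc p (padicLRadius p) L
  interpolation : ∀ n : ℕ, 1 ≤ n →
    L (1 - (n : ℂ_[p])) =
      -(1 - teichmullerTwist p χ n (p : ZMod _) * (p : ℂ_[p]) ^ (n - 1)) *
        (generalizedBernoulli p (teichmullerTwist p χ n) n / (n : ℂ_[p]))

/-- The `p`-adic `L`-function `L_p(s, χ)` of a Dirichlet character `χ`. Its values matter only on
the disc `|s| < q * p ^ (-1 / (p - 1))` and outside the possible pole `s = 1` for `χ = 1`, where
the defining properties determine them. -/
noncomputable def padicLFunction (p : ℕ) [Fact p.Prime] {f : ℕ}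
    (χ : DirichletCharacter ℂ_[p] f) : ℂ_[p] → ℂ_[p] :=
  Classical.epsilon (IsPadicLFunction p χ)

/-- `ε_{a,c,F} = (c - 1) / 2 - {-a F⁻¹}_c`, where `F` is prime to `c`, the inverse is taken modulo
`c`, and `{x}_c ∈ {0, …, c - 1}` represents the class `x` modulo `c`. -/
def dirichletEps (a : ℤ) (c F : ℕ) : ℚ :=
  ((c : ℚ) - 1) / 2 - ((-(a : ZMod c) * (F : ZMod c)⁻¹).val : ℚ)

/-- The sum of `χω⁻¹(a) ε_{a,c,F} / ⟨a⟩ ^ s` over the integers `1 ≤ a ≤ F` prime to `p`. -/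
noncomputable def padicDirichletSum (p : ℕ) [Fact p.Prime] {f : ℕ}
    (χ : DirichletCharacter ℂ_[p] f) (c F : ℕ) (s : ℂ_[p]) : ℂ_[p] :=
  ∑ a ∈ (Finset.Icc 1 F).filter (fun a => ¬ p ∣ a),
    teichmullerTwist p χ 1 (a : ZMod _) *
      ((dirichletEps (a : ℤ) c F : ℚ) : ℂ_[p]) / padicPow p (angleBracket p a) s

/-!
Write `F = f p ^ n`, and let all sums run over the integers `1 ≤ a ≤ F` prime to `p`.

*The `p`-adic `L`-function.* The power sums `F⁻¹ ∑ χ(a)⟨a⟩ ^ m` equal `F⁻¹ ∑ χω⁻ᵐ(a) a ^ m`. By the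
difference equation of the Bernoulli polynomials, the same sum over all `a ≤ F` is a combination of
difference quotients of `B_{m+1}(x) / (m + 1)` and tends to `B_{m,χω⁻ᵐ}`; the multiples of `p`
account for the Euler factor, so that the limit is
`(1 - χω⁻ᵐ(p) p ^ (m - 1)) B_{m,χω⁻ᵐ}` (`tendsto_inv_mul_sum_angleBracket_pow`). The sums
`F⁻¹ ∑ χ(a)(⟨a⟩ - 1) ^ j` are bounded by a constant times `q ^ (-j)` (`norm_inv_mul_sum_le`), hence
their limits `V j` are too, and `∑ binom(1 - s, j) V j` is a power series on the disc with these
values at `s = 1 - m`. It is `(s - 1) L_p(s, χ)`, and for `χ ≠ 1` it vanishes at `s = 1` and can be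
divided by `s - 1` (`exists_isPadicLFunction`).

*The sums with `ε`.* Let `k = {-a F⁻¹}_c`, so that `c a' = a + F k` for a permutation `a ↦ a'` of the
residues. Expanding `⟨c⟩⟨a'⟩ = ⟨a⟩ + F k / ω(a)` to first order in `F` evaluates the limit of
`∑ χω⁻¹(a) ε_{a,c,F} ⟨a⟩ ^ (m - 1)` as
`(1 - χ(c)⟨c⟩ ^ m)(1 - χω⁻ᵐ(p) p ^ (m - 1)) B_{m,χω⁻ᵐ} / m` (`tendsto_sum_dirichletEps_mul_pow`).
Since `ε_{a,c,F}` is `p`-integral, the sums `∑ χω⁻¹(a) ε_{a,c,F} (⟨a⟩ - 1) ^ j` are bounded by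
`q ^ (-j)`; so `∑ χω⁻¹(a) ε_{a,c,F} ⟨a⟩ ^ (-s)` converges on the disc, by dominated convergence, to a
Newton series in `-s` (`exists_tendsto_padicDirichletSum`).

*Comparison.* This limit and `-(1 - χ(c)⟨c⟩ ^ (1 - s)) L_p(s, χ)` agree at all `s = 1 - m`, `m ≥ 1`.
Both are power series on the disc, after multiplication by `s - 1` if `χ = 1`. These points accumulate
at `0`, so the identity theorem `IsAnalyticOnDisc.eq_zero` gives equality on the whole disc. At the
pole `s = 1` for `χ = 1` the limit follows from the continuity of the Newton series.
-/

/-! ### Norms of integers and the radius of the disc -/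

section Norms

variable {p : ℕ} [Fact p.Prime]

theorem PadicComplex.norm_natCast (n : ℕ) : ‖(n : ℂ_[p])‖ = ‖(n : ℚ_[p])‖ := by
  simpa using norm_algebraMap' ℂ_[p] (n : ℚ_[p])

theorem PadicComplex.norm_natCast_of_not_dvd {n : ℕ} (hn : ¬ p ∣ n) : ‖(n : ℂ_[p])‖ = 1 := by
  rw [PadicComplex.norm_natCast]
  exact Padic.norm_natCast_eq_one_iff.2 ((Nat.Prime.coprime_iff_not_dvd Fact.out).2 hn)

theorem PadicComplex.norm_prime : ‖(p : ℂ_[p])‖ = (p : ℝ)⁻¹ := by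
  rw [PadicComplex.norm_natCast, Padic.norm_p]

theorem PadicComplex.tendsto_mul_prime_pow (f : ℕ) :
    Tendsto (fun n : ℕ => ((f * p ^ n : ℕ) : ℂ_[p])) atTop (𝓝 0) := by
  have h : Tendsto (fun n : ℕ => (f : ℂ_[p]) * (p : ℂ_[p]) ^ n) atTop (𝓝 ((f : ℂ_[p]) * 0)) := by
    refine (tendsto_pow_atTop_nhds_zero_of_norm_lt_one ?_).const_mul _
    rw [PadicComplex.norm_prime]
    exact inv_lt_one_of_one_lt₀ (by exact_mod_cast (Fact.out : p.Prime).one_lt)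
  simpa using h

theorem padicQ_pos (p : ℕ) [Fact p.Prime] : 0 < padicQ p := by
  unfold padicQ
  split_ifs
  · norm_num
  · exact (Fact.out : p.Prime).pos

theorem dvd_padicQ (p : ℕ) : p ∣ padicQ p := by
  unfold padicQ
  split_ifs with h
  · rw [h]; norm_num
  · exact dvd_rfl

theorem padicQ_dvd_sq (p : ℕ) : padicQ p ∣ p ^ 2 := by
  unfold padicQ
  split_ifs with h
  · rw [h]; norm_num
  · exact dvd_pow_self p two_ne_zero

instance padicQ_neZero (p : ℕ) [Fact p.Prime] : NeZero (padicQ p) := ⟨(padicQ_pos p).ne'⟩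

theorem padicLRadius_eq_div (p : ℕ) [Fact p.Prime] :
    padicLRadius p = padicQ p / (p : ℝ) ^ (1 / ((p : ℝ) - 1)) := by
  have hp : (0 : ℝ) < p := by exact_mod_cast (Fact.out : p.Prime).pos
  rw [padicLRadius, neg_div, Real.rpow_neg hp.le, ← div_eq_mul_inv]

theorem one_lt_padicLRadius (p : ℕ) [Fact p.Prime] : 1 < padicLRadius p := by
  have hp : p.Prime := Fact.out
  have hp1 : (1 : ℝ) < p := by exact_mod_cast hp.one_lt
  rw [padicLRadius_eq_div, one_lt_div (Real.rpow_pos_of_pos (by linarith) _)]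
  unfold padicQ
  split_ifs with h
  · subst h
    norm_num
  · have h3 : (3 : ℝ) ≤ p := by
      exact_mod_cast (Nat.lt_of_le_of_ne hp.two_le (Ne.symm h) : 2 < p)
    calc (p : ℝ) ^ (1 / ((p : ℝ) - 1)) < (p : ℝ) ^ (1 : ℝ) := by
          refine Real.rpow_lt_rpow_of_exponent_lt hp1 ?_
          rw [div_lt_one] <;> linarith
      _ = (p : ℝ) := Real.rpow_one _

/-- Legendre's formula, as the lower bound `|j!| ≥ p ^ (-j / (p - 1))`. -/
theorem norm_factorial_inv_le (j : ℕ) :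
    ‖((j.factorial : ℕ) : ℂ_[p])⁻¹‖ ≤ ((p : ℝ) ^ (1 / ((p : ℝ) - 1))) ^ j := by
  have hp : p.Prime := Fact.out
  have hp1 : (1 : ℝ) < p := by exact_mod_cast hp.one_lt
  have hne : ((j.factorial : ℕ) : ℚ_[p]) ≠ 0 := by exact_mod_cast j.factorial_ne_zero
  rw [norm_inv, PadicComplex.norm_natCast, Padic.norm_eq_zpow_neg_valuation hne,
    Padic.valuation_natCast, zpow_neg, inv_inv, zpow_natCast, ← Real.rpow_natCast,
    ← Real.rpow_natCast _ j, ← Real.rpow_mul (by linarith)]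
  refine Real.rpow_le_rpow_of_exponent_le hp1.le ?_
  have h := sub_one_mul_padicValNat_factorial (p := p) j
  have h' : (p - 1) * padicValNat p j.factorial ≤ j := h ▸ Nat.sub_le _ _
  have h'' : ((p : ℝ) - 1) * (padicValNat p j.factorial : ℝ) ≤ j := by
    have := (Nat.cast_le (α := ℝ)).2 h'
    push_cast [Nat.cast_sub hp.one_le] at this
    exact this
  rw [one_div, ← div_eq_inv_mul, le_div_iff₀ (by linarith)]
  linarith

end Norms

/-! ### Power series on a disc of `ℂ_p` -/

section Analytic

variable {p : ℕ} [Fact p.Prime] {r : ℝ} {g h : ℂ_[p] → ℂ_[p]}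

theorem IsAnalyticOnDisc.add (hg : IsAnalyticOnDisc p r g) (hh : IsAnalyticOnDisc p r h) :
    IsAnalyticOnDisc p r (fun s => g s + h s) := by
  obtain ⟨b, hb⟩ := hg
  obtain ⟨d, hd⟩ := hh
  exact ⟨fun k => b k + d k, fun s hs => by simpa [add_mul] using (hb s hs).add (hd s hs)⟩

theorem IsAnalyticOnDisc.const_mul (c : ℂ_[p]) (hg : IsAnalyticOnDisc p r g) :
    IsAnalyticOnDisc p r (fun s => c * g s) := by
  obtain ⟨b, hb⟩ := hg
  exact ⟨fun k => c * b k, fun s hs => by simpa [mul_assoc] using (hb s hs).mul_left c⟩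

theorem IsAnalyticOnDisc.sub (hg : IsAnalyticOnDisc p r g) (hh : IsAnalyticOnDisc p r h) :
    IsAnalyticOnDisc p r (fun s => g s - h s) := by
  simpa [sub_eq_add_neg] using hg.add (hh.const_mul (-1))

theorem PadicComplex.hasSum_mul_antidiagonal {a b : ℕ → ℂ_[p]} {x y : ℂ_[p]}
    (ha : HasSum a x) (hb : HasSum b y) :
    HasSum (fun n => ∑ ij ∈ Finset.HasAntidiagonal.antidiagonal n, a ij.1 * b ij.2) (x * y) := by
  have : NonarchimedeanRing ℂ_[p] :=
    { is_nonarchimedean := NonarchimedeanAddGroup.is_nonarchimedean }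
  have h1 := ha.mul_of_nonarchimedean hb
  rw [← Finset.HasAntidiagonal.sigmaAntidiagonalEquivProd.hasSum_iff] at h1
  refine h1.sigma fun n => ?_
  have := Finset.hasSum (Finset.HasAntidiagonal.antidiagonal n) (fun ij : ℕ × ℕ => a ij.1 * b ij.2)
  exact this

theorem IsAnalyticOnDisc.mul (hg : IsAnalyticOnDisc p r g) (hh : IsAnalyticOnDisc p r h) :
    IsAnalyticOnDisc p r (fun s => g s * h s) := by
  obtain ⟨b, hb⟩ := hg
  obtain ⟨d, hd⟩ := hh
  refine ⟨fun n => ∑ ij ∈ Finset.HasAntidiagonal.antidiagonal n, b ij.1 * d ij.2, fun s hs => ?_⟩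
  refine (PadicComplex.hasSum_mul_antidiagonal (hb s hs) (hd s hs)).congr_fun ?_
  intro n
  rw [Finset.sum_mul]
  refine Finset.sum_congr rfl fun ij hij => ?_
  rw [← Finset.HasAntidiagonal.mem_antidiagonal.1 hij]
  ring

theorem Polynomial.hasSum_coeff_mul_pow (P : Polynomial ℂ_[p]) (s : ℂ_[p]) :
    HasSum (fun k => P.coeff k * s ^ k) (P.eval s) := by
  rw [Polynomial.eval_eq_sum, Polynomial.sum]
  exact hasSum_sum_of_ne_finset_zero fun k hk => by
    rw [Polynomial.notMem_support_iff.1 hk, zero_mul]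

theorem isAnalyticOnDisc_polynomial (P : Polynomial ℂ_[p]) :
    IsAnalyticOnDisc p r (fun s => P.eval s) :=
  ⟨P.coeff, fun s _ => P.hasSum_coeff_mul_pow s⟩

/-- Over a non-archimedean field a double series converges unconditionally as soon as its terms
tend to `0`. -/
theorem summable_coeff_mul_pow_of_tendsto (P : ℕ → Polynomial ℂ_[p]) (B : ℕ → ℝ)
    (hdeg : ∀ j, (P j).natDegree ≤ j) (hB : ∀ j k, ‖(P j).coeff k‖ ≤ B j) {s : ℂ_[p]}
    (hlim : Tendsto (fun j => B j * max 1 ‖s‖ ^ j) atTop (𝓝 0)) :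
    Summable (fun x : ℕ × ℕ => (P x.1).coeff x.2 * s ^ x.2) := by
  have hB0 : ∀ j, 0 ≤ B j := fun j => (norm_nonneg _).trans (hB j 0)
  refine NonarchimedeanAddGroup.summable_of_tendsto_cofinite_zero ?_
  rw [Metric.tendsto_nhds]
  intro ε hε
  obtain ⟨J, hJ⟩ := eventually_atTop.1 (hlim.eventually (gt_mem_nhds hε))
  rw [Filter.eventually_cofinite]
  refine ((Finset.range J) ×ˢ (Finset.range J)).finite_toSet.subset fun x hx => ?_
  simp only [Set.mem_ofPred_eq, dist_zero_right, not_lt] at hx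
  have hle : x.2 ≤ x.1 := by
    by_contra hcon
    rw [Polynomial.coeff_eq_zero_of_natDegree_lt ((hdeg x.1).trans_lt (not_le.1 hcon))] at hx
    simp only [zero_mul, norm_zero] at hx
    linarith
  have hlt : x.1 < J := by
    by_contra hcon
    refine absurd (hJ x.1 (not_lt.1 hcon)) (not_lt.2 (hx.trans ?_))
    rw [norm_mul, norm_pow]
    refine mul_le_mul (hB _ _) ?_ (by positivity) (hB0 _)
    calc ‖s‖ ^ x.2 ≤ max 1 ‖s‖ ^ x.2 := by gcongr; exact le_max_right _ _
      _ ≤ max 1 ‖s‖ ^ x.1 := pow_le_pow_right₀ (le_max_left _ _) hle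
  simp only [Finset.coe_product, Set.mem_prod, Finset.mem_coe, Finset.mem_range]
  exact ⟨hlt, hle.trans_lt hlt⟩

/-- A series of polynomials `P j` of degree at most `j` is a power series on the disc of radius `r`,
as soon as the coefficients of `P j` are bounded by `B j` with `B j * max 1 ‖s‖ ^ j → 0` for every
`s` of the disc. -/
theorem isAnalyticOnDisc_tsum_polynomial (P : ℕ → Polynomial ℂ_[p]) (B : ℕ → ℝ)
    (hr : 1 < r) (hdeg : ∀ j, (P j).natDegree ≤ j) (hB : ∀ j k, ‖(P j).coeff k‖ ≤ B j)
    (hlim : ∀ s : ℂ_[p], ‖s‖ < r → Tendsto (fun j => B j * max 1 ‖s‖ ^ j) atTop (𝓝 0)) :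
    IsAnalyticOnDisc p r (fun s => ∑' j, (P j).eval s) := by
  -- the sum at `s = 1`, a point of the disc, shows that the coefficient series converges
  have h1 : ∀ k, Summable (fun j => (P j).coeff k) := fun k => by
    have h := summable_coeff_mul_pow_of_tendsto P B hdeg hB (hlim 1 (by simpa using hr))
    simp only [one_pow, mul_one] at h
    exact h.prod_symm.prod_factor k
  refine ⟨fun k => ∑' j, (P j).coeff k, fun s hs => ?_⟩
  have hsum := summable_coeff_mul_pow_of_tendsto P B hdeg hB (hlim s hs)
  have e : ∑' j, (P j).eval s = ∑' x : ℕ × ℕ, (P x.2).coeff x.1 * s ^ x.1 := by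
    rw [(hsum.hasSum.prod_fiberwise fun j => (P j).hasSum_coeff_mul_pow s).tsum_eq]
    exact ((Equiv.prodComm ℕ ℕ).tsum_eq fun x : ℕ × ℕ => (P x.1).coeff x.2 * s ^ x.2).symm
  have hswap : Summable (fun x : ℕ × ℕ => (P x.2).coeff x.1 * s ^ x.1) := hsum.prod_symm
  show HasSum (fun k => (∑' j, (P j).coeff k) * s ^ k) (∑' j, (P j).eval s)
  rw [e]
  exact hswap.hasSum.prod_fiberwise fun k => (h1 k).hasSum.mul_right (s ^ k)

/-- The identity theorem: the points `1 - m` accumulate at `0`, along `m = 1 + p ^ n`, and a power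
series whose zeros accumulate at its centre has zero coefficients. -/
theorem IsAnalyticOnDisc.eq_zero (hr : 1 < r) (hg : IsAnalyticOnDisc p r g)
    (h0 : ∀ m : ℕ, 1 ≤ m → g (1 - (m : ℂ_[p])) = 0) {s : ℂ_[p]} (hs : ‖s‖ < r) : g s = 0 := by
  obtain ⟨b, hb⟩ := hg
  have hps : HasFPowerSeriesAt g (FormalMultilinearSeries.ofScalars ℂ_[p] b) 0 := by
    rw [hasFPowerSeriesAt_iff]
    filter_upwards [Metric.ball_mem_nhds (0 : ℂ_[p]) (by linarith : (0 : ℝ) < r)] with z hz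
    rw [mem_ball_zero_iff] at hz
    simpa [FormalMultilinearSeries.coeff_ofScalars, mul_comm] using hb z hz
  have hfreq : ∃ᶠ z in 𝓝[≠] (0 : ℂ_[p]), g z = 0 := by
    have hp0 : (p : ℂ_[p]) ≠ 0 := by exact_mod_cast (Fact.out : p.Prime).ne_zero
    have ht : Tendsto (fun n : ℕ => (1 : ℂ_[p]) - ((1 + p ^ n : ℕ) : ℂ_[p])) atTop
        (𝓝[≠] (0 : ℂ_[p])) := by
      refine tendsto_nhdsWithin_iff.2 ⟨?_, Eventually.of_forall fun n => ?_⟩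
      · have := (PadicComplex.tendsto_mul_prime_pow (p := p) 1).neg
        simpa using this
      · simp [hp0]
    exact ht.frequently (Frequently.of_forall fun n => h0 _ (by omega))
  have hz := hps.eq_zero_of_eventually (hps.analyticAt.frequently_zero_iff_eventually_zero.1 hfreq)
  have hb0 : b = 0 := (FormalMultilinearSeries.ofScalars_series_eq_zero (E := ℂ_[p]) (c := b)).1 hz
  have := hb s hs
  simp only [hb0, Pi.zero_apply, zero_mul] at this
  exact this.unique hasSum_zero

theorem IsAnalyticOnDisc.eqOn_of_eq_one_sub_natCast (hr : 1 < r) (hg : IsAnalyticOnDisc p r g)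
    (hh : IsAnalyticOnDisc p r h)
    (h0 : ∀ m : ℕ, 1 ≤ m → g (1 - (m : ℂ_[p])) = h (1 - (m : ℂ_[p])))
    {s : ℂ_[p]} (hs : ‖s‖ < r) : g s = h s :=
  sub_eq_zero.1 ((hg.sub hh).eq_zero hr (fun m hm => sub_eq_zero.2 (h0 m hm)) hs)

/-- A power series that vanishes at `1` is divisible by `s - 1`, with a quotient that converges on
the same disc: `∑ b i * s ^ i = (s - 1) * ∑ b i * (1 + s + ⋯ + s ^ (i - 1))`. -/
theorem IsAnalyticOnDisc.exists_eq_sub_one_mul (hr : 1 < r) (hg : IsAnalyticOnDisc p r g)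
    (h1 : g 1 = 0) :
    ∃ d, IsAnalyticOnDisc p r d ∧ ∀ s, ‖s‖ < r → g s = (s - 1) * d s := by
  obtain ⟨b, hb⟩ := hg
  have hb1 : HasSum b 0 := by simpa [h1] using hb 1 (by simpa using hr)
  let P : ℕ → Polynomial ℂ_[p] := fun i =>
    Polynomial.C (b i) * ∑ k ∈ Finset.range i, Polynomial.X ^ k
  have hcoeff : ∀ i k, (P i).coeff k = if k < i then b i else 0 := fun i k => by
    simp [P, Polynomial.finsetSum_coeff, Polynomial.coeff_X_pow]
  have han : IsAnalyticOnDisc p r (fun s => ∑' j, (P j).eval s) := by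
    refine isAnalyticOnDisc_tsum_polynomial P (fun i => ‖b i‖) hr (fun j => ?_) (fun j k => ?_)
      (fun s hs => ?_)
    · refine Polynomial.natDegree_le_iff_coeff_eq_zero.2 fun N hN => ?_
      rw [hcoeff, if_neg (by omega)]
    · rw [hcoeff]
      split_ifs <;> simp
    · have ha := (hb s hs).summable.tendsto_atTop_zero.norm
      have hc := hb1.summable.tendsto_atTop_zero.norm
      rw [norm_zero] at ha hc
      refine squeeze_zero (fun j => by positivity) (fun j => ?_) (by simpa using ha.add hc)
      rcases max_choice 1 ‖s‖ with e | e <;> rw [e]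
      · simpa using by positivity
      · simp
  refine ⟨_, han, fun s hs => ?_⟩
  have e : ∀ i, (s - 1) * (P i).eval s = b i * s ^ i - b i := fun i => by
    simp only [P, Polynomial.eval_mul, Polynomial.eval_C, Polynomial.eval_finsetSum,
      Polynomial.eval_pow, Polynomial.eval_X]
    rw [mul_left_comm, mul_geom_sum]
    ring
  rw [← tsum_mul_left]
  simp only [e]
  simpa using ((hb s hs).sub hb1).tsum_eq.symm

end Analytic

/-! ### Newton series with rapidly decreasing coefficients -/

section Binomial

variable {p : ℕ} [Fact p.Prime]

/-- The polynomial `binom(u - X, j)`, for an integer `u`. -/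
noncomputable def binomialPolynomial (p : ℕ) [Fact p.Prime] (u : ℤ) (j : ℕ) :
    Polynomial ℂ_[p] :=
  Polynomial.C ((j.factorial : ℕ) : ℂ_[p])⁻¹ *
    ((descPochhammer ℤ j).comp (Polynomial.C u - Polynomial.X)).map (Int.castRingHom ℂ_[p])

theorem eval_binomialPolynomial (u : ℤ) (j : ℕ) (s : ℂ_[p]) :
    (binomialPolynomial p u j).eval s = Ring.choose ((u : ℂ_[p]) - s) j := by
  rw [binomialPolynomial, Ring.choose_eq_smul, Polynomial.eval_mul, Polynomial.eval_C, smul_eq_mul,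
    Polynomial.map_comp, Polynomial.eval_comp, ← Polynomial.aeval_eq_smeval, Polynomial.aeval_def,
    Polynomial.eval_map]
  simp [Polynomial.eval₂_eq_eval_map]

theorem natDegree_binomialPolynomial_le (u : ℤ) (j : ℕ) :
    (binomialPolynomial p u j).natDegree ≤ j := by
  refine (Polynomial.natDegree_C_mul_le _ _).trans (Polynomial.natDegree_map_le.trans ?_)
  refine Polynomial.natDegree_comp_le.trans ?_
  rw [descPochhammer_natDegree]
  have : (Polynomial.C u - Polynomial.X : Polynomial ℤ).natDegree ≤ 1 := by
    refine (Polynomial.natDegree_sub_le _ _).trans ?_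
    simp
  nlinarith

theorem norm_coeff_binomialPolynomial_le (u : ℤ) (j k : ℕ) :
    ‖(binomialPolynomial p u j).coeff k‖ ≤ ((p : ℝ) ^ (1 / ((p : ℝ) - 1))) ^ j := by
  rw [binomialPolynomial, Polynomial.coeff_C_mul, Polynomial.coeff_map, norm_mul, eq_intCast]
  calc _ ≤ ((p : ℝ) ^ (1 / ((p : ℝ) - 1))) ^ j * 1 := by
        gcongr
        · exact norm_factorial_inv_le j
        · exact IsUltrametricDist.norm_intCast_le_one _ _
    _ = _ := mul_one _

theorem norm_choose_le (s : ℂ_[p]) (j : ℕ) :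
    ‖Ring.choose s j‖ ≤ ((p : ℝ) ^ (1 / ((p : ℝ) - 1)) * max 1 ‖s‖) ^ j := by
  have h := eval_binomialPolynomial (p := p) 0 j (-s)
  rw [Int.cast_zero, zero_sub, neg_neg] at h
  rw [← h, Polynomial.eval_eq_sum_range]
  refine IsUltrametricDist.norm_sum_le_of_forall_le_of_nonneg (by positivity) fun k hk => ?_
  have hk' : k ≤ j :=
    (Nat.lt_succ_iff.1 (Finset.mem_range.1 hk)).trans (natDegree_binomialPolynomial_le 0 j)
  rw [norm_mul, norm_pow, norm_neg, mul_pow]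
  gcongr
  · exact norm_coeff_binomialPolynomial_le 0 j k
  · calc ‖s‖ ^ k ≤ max 1 ‖s‖ ^ k := by gcongr; exact le_max_right _ _
      _ ≤ max 1 ‖s‖ ^ j := pow_le_pow_right₀ (le_max_left _ _) hk'

theorem norm_choose_mul_le {C : ℝ} {u : ℂ_[p]} {j : ℕ} (s : ℂ_[p])
    (hu : ‖u‖ ≤ C * ((padicQ p : ℝ)⁻¹) ^ j) :
    ‖Ring.choose s j * u‖ ≤ C * (max 1 ‖s‖ / padicLRadius p) ^ j := by
  rw [norm_mul]
  calc _ ≤ ((p : ℝ) ^ (1 / ((p : ℝ) - 1)) * max 1 ‖s‖) ^ j * (C * ((padicQ p : ℝ)⁻¹) ^ j) :=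
        mul_le_mul (norm_choose_le s j) hu (norm_nonneg _) (by positivity)
    _ = _ := by
        rw [padicLRadius_eq_div, mul_left_comm, ← mul_pow, div_div_eq_mul_div]
        congr 2
        ring

/-- The series `∑ binom(s, j) * M j`. -/
noncomputable def newtonSeries (p : ℕ) [Fact p.Prime] (M : ℕ → ℂ_[p]) (s : ℂ_[p]) : ℂ_[p] :=
  ∑' j : ℕ, Ring.choose s j * M j

variable {M : ℕ → ℂ_[p]} {C : ℝ}

theorem max_one_norm_div_padicLRadius_lt_one {s : ℂ_[p]} (hs : ‖s‖ < padicLRadius p) :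
    max 1 ‖s‖ / padicLRadius p < 1 := by
  have hR := one_lt_padicLRadius p
  rw [div_lt_one (by linarith)]
  exact max_lt hR hs

theorem summable_const_mul_max_pow (C : ℝ) {s : ℂ_[p]} (hs : ‖s‖ < padicLRadius p) :
    Summable (fun j : ℕ => C * (max 1 ‖s‖ / padicLRadius p) ^ j) := by
  have hR := one_lt_padicLRadius p
  exact (summable_geometric_of_lt_one (by positivity)
    (max_one_norm_div_padicLRadius_lt_one hs)).mul_left C

theorem hasSum_newtonSeries (hM : ∀ j, ‖M j‖ ≤ C * ((padicQ p : ℝ)⁻¹) ^ j) {s : ℂ_[p]}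
    (hs : ‖s‖ < padicLRadius p) :
    HasSum (fun j => Ring.choose s j * M j) (newtonSeries p M s) :=
  ((summable_const_mul_max_pow C hs).of_norm_bounded
    fun j => norm_choose_mul_le s (hM j)).hasSum

theorem isAnalyticOnDisc_newtonSeries (hM : ∀ j, ‖M j‖ ≤ C * ((padicQ p : ℝ)⁻¹) ^ j) (u : ℤ) :
    IsAnalyticOnDisc p (padicLRadius p) (fun s => newtonSeries p M ((u : ℂ_[p]) - s)) := by
  have h := isAnalyticOnDisc_tsum_polynomial (p := p) (r := padicLRadius p)
    (fun j => binomialPolynomial p u j * Polynomial.C (M j))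
    (fun j => C * ((padicLRadius p)⁻¹) ^ j) (one_lt_padicLRadius p)
    (fun j => (Polynomial.natDegree_mul_C_le _ _).trans (natDegree_binomialPolynomial_le u j))
    (fun j k => ?_) (fun s hs => ?_)
  · simp only [Polynomial.eval_mul, Polynomial.eval_C, eval_binomialPolynomial] at h
    exact h
  · rw [Polynomial.coeff_mul_C, norm_mul]
    calc _ ≤ ((p : ℝ) ^ (1 / ((p : ℝ) - 1))) ^ j * (C * ((padicQ p : ℝ)⁻¹) ^ j) :=
          mul_le_mul (norm_coeff_binomialPolynomial_le u j k) (hM j) (norm_nonneg _)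
            (by positivity)
      _ = _ := by
          rw [padicLRadius_eq_div, mul_left_comm, ← mul_pow, inv_div, ← div_eq_mul_inv]
  · have := (summable_const_mul_max_pow C hs).tendsto_atTop_zero
    refine this.congr fun j => ?_
    rw [div_eq_mul_inv, mul_pow]
    ring

theorem newtonSeries_natCast (M : ℕ → ℂ_[p]) (m : ℕ) :
    newtonSeries p M (m : ℂ_[p]) = ∑ j ∈ Finset.range (m + 1), (m.choose j : ℂ_[p]) * M j := by
  rw [newtonSeries, tsum_eq_sum (s := Finset.range (m + 1)) fun j hj => ?_]
  · exact Finset.sum_congr rfl fun j _ => by rw [Ring.choose_natCast]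
  · rw [Ring.choose_natCast, Nat.choose_eq_zero_of_lt (by simpa using hj), Nat.cast_zero, zero_mul]

theorem tendsto_newtonSeries {N : ℕ → ℕ → ℂ_[p]} {n₀ : ℕ}
    (hN : ∀ n, n₀ ≤ n → ∀ j, ‖N n j‖ ≤ C * ((padicQ p : ℝ)⁻¹) ^ j)
    (hlim : ∀ j, Tendsto (fun n => N n j) atTop (𝓝 (M j))) {s : ℂ_[p]}
    (hs : ‖s‖ < padicLRadius p) :
    Tendsto (fun n => newtonSeries p (N n) s) atTop (𝓝 (newtonSeries p M s)) :=
  tendsto_tsum_of_dominated_convergence (summable_const_mul_max_pow C hs)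
    (fun j => (hlim j).const_mul _)
    ((eventually_ge_atTop n₀).mono fun n hn j => norm_choose_mul_le s (hN n hn j))

theorem tendsto_newtonSeries_neg_one (hM : ∀ j, ‖M j‖ ≤ C * ((padicQ p : ℝ)⁻¹) ^ j) :
    Tendsto (fun s => newtonSeries p M (-s)) (𝓝 1) (𝓝 (newtonSeries p M (-1))) := by
  have h1 : ‖(1 : ℂ_[p])‖ < padicLRadius p := by simpa using one_lt_padicLRadius p
  refine tendsto_tsum_of_dominated_convergence (summable_const_mul_max_pow C h1) (fun j => ?_) ?_
  · have := ((binomialPolynomial p 0 j).continuous.tendsto 1).mul_const (M j)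
    simpa [eval_binomialPolynomial] using this
  · filter_upwards [Metric.ball_mem_nhds (1 : ℂ_[p]) one_pos] with s hs j
    have hs1 : ‖-s‖ ≤ 1 := by
      rw [mem_ball_iff_norm] at hs
      have := IsUltrametricDist.norm_add_le_max (s - 1) (1 : ℂ_[p])
      rw [sub_add_cancel, norm_one] at this
      rw [norm_neg]
      exact this.trans (max_le hs.le le_rfl)
    have := norm_choose_mul_le (-s) (hM j)
    rwa [max_eq_left hs1, ← max_eq_left (norm_one (α := ℂ_[p])).le] at this

theorem norm_sub_one_pow_le {x : ℂ_[p]} (hx : ‖x - 1‖ ≤ (padicQ p : ℝ)⁻¹) (j : ℕ) :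
    ‖(x - 1) ^ j‖ ≤ 1 * ((padicQ p : ℝ)⁻¹) ^ j := by
  rw [norm_pow, one_mul]
  gcongr

theorem padicPow_natCast (x : ℂ_[p]) (m : ℕ) : padicPow p x (m : ℂ_[p]) = x ^ m := by
  have h := newtonSeries_natCast (fun j => (x - 1) ^ j) m
  rw [newtonSeries] at h
  rw [padicPow, h]
  conv_rhs => rw [← sub_add_cancel x 1, add_pow]
  exact Finset.sum_congr rfl fun j _ => by ring

theorem padicPow_mul_padicPow_neg {x s : ℂ_[p]} (hx : ‖x - 1‖ ≤ (padicQ p : ℝ)⁻¹)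
    (hs : ‖s‖ < padicLRadius p) : padicPow p x s * padicPow p x (-s) = 1 := by
  have h1 := hasSum_newtonSeries (norm_sub_one_pow_le hx) hs
  have h2 := hasSum_newtonSeries (norm_sub_one_pow_le hx) (s := -s) (by rwa [norm_neg])
  have h3 := (PadicComplex.hasSum_mul_antidiagonal h1 h2).tsum_eq
  have h4 := padicPow_natCast x 0
  rw [Nat.cast_zero, pow_zero, padicPow] at h4
  show newtonSeries p (fun j => (x - 1) ^ j) s * newtonSeries p (fun j => (x - 1) ^ j) (-s) = 1
  rw [← h3]
  refine Eq.trans ?_ h4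
  refine tsum_congr fun n => ?_
  rw [← add_neg_cancel s, Ring.add_choose_eq n (Commute.all _ _), Finset.sum_mul]
  refine Finset.sum_congr rfl fun ij hij => ?_
  rw [← Finset.HasAntidiagonal.mem_antidiagonal.1 hij]
  ring

theorem inv_padicPow {x s : ℂ_[p]} (hx : ‖x - 1‖ ≤ (padicQ p : ℝ)⁻¹)
    (hs : ‖s‖ < padicLRadius p) : (padicPow p x s)⁻¹ = padicPow p x (-s) :=
  inv_eq_of_mul_eq_one_right (padicPow_mul_padicPow_neg hx hs)

end Binomial

/-! ### The Teichmüller character and the primitive characters `χω⁻ⁿ` -/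

section Teichmuller

variable {p : ℕ} [Fact p.Prime]

theorem isUnit_natCast_padicQ {a : ℕ} (ha : ¬ p ∣ a) : IsUnit (a : ZMod (padicQ p)) := by
  rw [ZMod.isUnit_iff_coprime]
  exact (((Nat.Prime.coprime_iff_not_dvd Fact.out).2 ha).symm.pow_right 2).coprime_dvd_right
    (padicQ_dvd_sq p)

theorem norm_teichmullerCharacter_sub_le {a : ℕ} (ha : ¬ p ∣ a) :
    ‖teichmullerCharacter p a - (a : ℂ_[p])‖ ≤ (padicQ p : ℝ)⁻¹ :=
  Classical.choose_spec (exists_teichmullerCharacter p) a ha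

theorem inv_padicQ_lt_one (p : ℕ) [Fact p.Prime] : (padicQ p : ℝ)⁻¹ < 1 := by
  refine inv_lt_one_of_one_lt₀ ?_
  exact_mod_cast (Fact.out : p.Prime).one_lt.trans_le (Nat.le_of_dvd (padicQ_pos p) (dvd_padicQ p))

theorem teichmullerCharacter_ne_zero {a : ℕ} (ha : ¬ p ∣ a) :
    teichmullerCharacter p (a : ZMod (padicQ p)) ≠ 0 :=
  ((isUnit_natCast_padicQ ha).map _).ne_zero

theorem norm_teichmullerCharacter {a : ℕ} (ha : ¬ p ∣ a) :
    ‖teichmullerCharacter p (a : ZMod (padicQ p))‖ = 1 := by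
  have h := (norm_teichmullerCharacter_sub_le ha).trans_lt (inv_padicQ_lt_one p)
  rw [← PadicComplex.norm_natCast_of_not_dvd ha] at h ⊢
  rw [sub_eq_add_neg] at h
  rw [← norm_neg (a : ℂ_[p])] at h ⊢
  exact IsUltrametricDist.norm_eq_of_add_norm_lt_max (h.trans_le (le_max_right _ _))

theorem norm_angleBracket_sub_one_le {a : ℕ} (ha : ¬ p ∣ a) :
    ‖angleBracket p a - 1‖ ≤ (padicQ p : ℝ)⁻¹ := by
  rw [angleBracket, div_sub_one (teichmullerCharacter_ne_zero ha), norm_div,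
    norm_teichmullerCharacter ha, div_one, norm_sub_rev]
  exact norm_teichmullerCharacter_sub_le ha

theorem norm_angleBracket {a : ℕ} (ha : ¬ p ∣ a) : ‖angleBracket p a‖ = 1 := by
  rw [angleBracket, norm_div, norm_teichmullerCharacter ha,
    PadicComplex.norm_natCast_of_not_dvd ha, div_one]

theorem angleBracket_mul (a b : ℕ) :
    angleBracket p (a * b) = angleBracket p a * angleBracket p b := by
  simp only [angleBracket, Nat.cast_mul, map_mul]
  rw [mul_div_mul_comm]

theorem angleBracket_add_mul {F : ℕ} (hF : padicQ p ∣ F) (a t : ℕ) :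
    angleBracket p (a + F * t) =
      angleBracket p a + F * (t / teichmullerCharacter p (a : ZMod (padicQ p))) := by
  have h : ((a + F * t : ℕ) : ZMod (padicQ p)) = a := by
    rw [Nat.cast_add, Nat.cast_mul, (ZMod.natCast_eq_zero_iff F _).2 hF, zero_mul, add_zero]
  rw [angleBracket, angleBracket, h]
  push_cast
  ring

theorem lcm_padicQ_dvd (p f : ℕ) : Nat.lcm f (padicQ p) ∣ f * p ^ 2 :=
  Nat.lcm_dvd (dvd_mul_right _ _) ((padicQ_dvd_sq p).trans (dvd_mul_left _ _))

theorem conductor_twist_dvd {f : ℕ} (χ : DirichletCharacter ℂ_[p] f) (n : ℕ) :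
    (χ.mul ((teichmullerCharacter p)⁻¹ ^ n)).conductor ∣ f * p ^ 2 :=
  (DirichletCharacter.conductor_dvd_level _).trans (lcm_padicQ_dvd p f)

variable {f : ℕ} [NeZero f]

theorem lcm_padicQ_ne_zero (p f : ℕ) [Fact p.Prime] [NeZero f] : Nat.lcm f (padicQ p) ≠ 0 :=
  Nat.lcm_ne_zero (NeZero.ne f) (NeZero.ne _)

/-- The conductors of `χ` and `χω⁻ⁿ` differ only by a power of `p`. -/
theorem dvd_lcm_conductor_twist {χ : DirichletCharacter ℂ_[p] f} (hχ : χ.IsPrimitive) (n : ℕ) :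
    f ∣ Nat.lcm (χ.mul ((teichmullerCharacter p)⁻¹ ^ n)).conductor (padicQ p) := by
  have : NeZero (Nat.lcm f (padicQ p)) := ⟨lcm_padicQ_ne_zero p f⟩
  set τ := DirichletCharacter.changeLevel (Nat.dvd_lcm_right f (padicQ p))
    ((teichmullerCharacter p) ^ n) with hτ
  have h := DirichletCharacter.conductor_mul_dvd_lcm_conductor
    (χ.mul ((teichmullerCharacter p)⁻¹ ^ n)) τ
  have e : χ.mul ((teichmullerCharacter p)⁻¹ ^ n) * τ =
      DirichletCharacter.changeLevel (Nat.dvd_lcm_left f (padicQ p)) χ := by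
    rw [DirichletCharacter.mul, mul_assoc, hτ, ← map_mul, ← mul_pow, inv_mul_cancel, one_pow,
      map_one, mul_one]
  rw [e, DirichletCharacter.conductor_changeLevel, hχ] at h
  refine h.trans (Nat.lcm_dvd (Nat.dvd_lcm_left _ _) (dvd_trans ?_ (Nat.dvd_lcm_right _ _)))
  rw [hτ, DirichletCharacter.conductor_changeLevel]
  exact DirichletCharacter.conductor_dvd_level _

/-- Away from `p` the primitive character `χω⁻ⁿ` is the pointwise product; both sides vanish at
the integers that have a common factor with the prime-to-`p` part of the conductor. -/
theorem teichmullerTwist_apply {χ : DirichletCharacter ℂ_[p] f} (hχ : χ.IsPrimitive) (n : ℕ)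
    {a : ℕ} (ha : ¬ p ∣ a) :
    teichmullerTwist p χ n (a : ZMod _) =
      χ (a : ZMod f) * ((teichmullerCharacter p (a : ZMod (padicQ p)))⁻¹) ^ n := by
  have : NeZero (Nat.lcm f (padicQ p)) := ⟨lcm_padicQ_ne_zero p f⟩
  have haq : Nat.Coprime a (padicQ p) := (ZMod.isUnit_iff_coprime _ _).1 (isUnit_natCast_padicQ ha)
  rw [teichmullerTwist, DirichletCharacter.mul_def]
  by_cases hf : Nat.Coprime a f
  · have hl : IsCoprime (a : ℤ) (Nat.lcm f (padicQ p) : ℕ) :=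
      Nat.isCoprime_iff_coprime.2 ((hf.mul_right haq).coprime_dvd_right (Nat.lcm_dvd_mul _ _))
    have h := DirichletCharacter.primitiveCharacter_apply_of_isCoprime
      (χ.mul ((teichmullerCharacter p)⁻¹ ^ n)) hl
    rw [Int.cast_natCast, Int.cast_natCast] at h
    rw [h, DirichletCharacter.mul, MulChar.mul_apply, ← Int.cast_natCast a,
      DirichletCharacter.changeLevel_eq_cast_of_dvd' _ _ hl,
      DirichletCharacter.changeLevel_eq_cast_of_dvd' _ _ hl, Int.cast_natCast, Int.cast_natCast]
    obtain ⟨u, hu⟩ := isUnit_natCast_padicQ ha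
    rw [← hu, MulChar.pow_apply_coe, MulChar.inv_apply_eq_inv']
  · have h1 : χ (a : ZMod f) = 0 :=
      χ.map_nonunit fun h => hf ((ZMod.isUnit_iff_coprime _ _).1 h)
    rw [h1, zero_mul]
    refine MulChar.map_nonunit _ fun h => hf ?_
    have h2 := (ZMod.isUnit_iff_coprime _ _).1 h
    exact ((h2.mul_right haq).coprime_dvd_right (Nat.lcm_dvd_mul _ _)).coprime_dvd_right
      (dvd_lcm_conductor_twist hχ n)

end Teichmuller

/-! ### Generalized Bernoulli numbers as limits of power sums -/

section PowerSums

theorem Finset.sum_Icc_one_mul {M : Type*} [AddCommMonoid M] (h : ℕ → M) (N T : ℕ) :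
    ∑ a ∈ Finset.Icc 1 (N * T), h a =
      ∑ a ∈ Finset.Icc 1 N, ∑ t ∈ Finset.range T, h (a + N * t) := by
  have key : ∀ (n : ℕ) (g : ℕ → M), ∑ a ∈ Finset.Icc 1 n, g a = ∑ i ∈ Finset.range n, g (i + 1) :=
    fun n g => by
      induction n with
      | zero => simp
      | succ n ih => rw [Finset.sum_Icc_succ_top (by omega), Finset.sum_range_succ, ih]
  rw [Finset.sum_comm]
  induction T with
  | zero => simp
  | succ T ih =>
    rw [Finset.sum_range_succ, ← ih, key, key, key, mul_add_one, Finset.sum_range_add]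
    congr 1
    exact Finset.sum_congr rfl fun i _ => by congr 1; ring

theorem Polynomial.bernoulli_eval_add_natCast (m T : ℕ) (x : ℚ) :
    (Polynomial.bernoulli (m + 1)).eval (x + T) =
      (Polynomial.bernoulli (m + 1)).eval x + (m + 1) * ∑ t ∈ Finset.range T, (x + t) ^ m := by
  induction T with
  | zero => simp
  | succ T ih =>
    rw [Finset.sum_range_succ, mul_add, ← add_assoc, ← ih, Nat.cast_succ, ← add_assoc, add_comm _ 1,
      Polynomial.bernoulli_eval_one_add]
    simp

variable {p : ℕ} [Fact p.Prime]

/-- The difference quotients of a Bernoulli polynomial at `x`, along positive integers `T` that tend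
to `0` in `ℂ_p`, are normalized power sums. -/
theorem tendsto_inv_mul_sum_add_pow (x : ℚ) (m : ℕ) {T : ℕ → ℕ} (hT : ∀ n, T n ≠ 0)
    (hlim : Tendsto (fun n => (T n : ℂ_[p])) atTop (𝓝 0)) :
    Tendsto (fun n => (T n : ℂ_[p])⁻¹ * ∑ t ∈ Finset.range (T n), ((x : ℂ_[p]) + t) ^ m) atTop
      (𝓝 (((Polynomial.bernoulli m).eval x : ℚ) : ℂ_[p])) := by
  set P : Polynomial ℂ_[p] := (Polynomial.bernoulli (m + 1)).map (Rat.castHom ℂ_[p]) with hP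
  have hm : ((m : ℂ_[p]) + 1) ≠ 0 := by exact_mod_cast m.succ_ne_zero
  have heval : ∀ (R : Polynomial ℚ) (y : ℚ),
      (R.map (Rat.castHom ℂ_[p])).eval (y : ℂ_[p]) = ((R.eval y : ℚ) : ℂ_[p]) := fun R y => by
    rw [Polynomial.eval_map, ← Rat.coe_castHom, Polynomial.eval₂_at_apply]
  have hd := hasDerivAt_iff_tendsto_slope_zero.1 (P.hasDerivAt (x : ℂ_[p]))
  have hT' : Tendsto (fun n => (T n : ℂ_[p])) atTop (𝓝[≠] 0) :=
    tendsto_nhdsWithin_iff.2 ⟨hlim, Eventually.of_forall fun n => by simpa using hT n⟩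
  have h := (hd.comp hT').const_mul ((m : ℂ_[p]) + 1)⁻¹
  rw [hP, Polynomial.derivative_map, Polynomial.derivative_bernoulli_add_one, heval] at h
  refine (h.congr fun n => ?_).trans_eq ?_
  · have e := congrArg (fun y : ℚ => (y : ℂ_[p]))
      (Polynomial.bernoulli_eval_add_natCast m (T n) x)
    simp only [Function.comp_apply, smul_eq_mul]
    rw [← Rat.cast_natCast (T n), ← Rat.cast_add, heval]
    push_cast at e ⊢
    rw [e, add_sub_cancel_left]
    field_simp
  · congr 1
    rw [Polynomial.map_mul, Polynomial.eval_mul, heval (Polynomial.bernoulli m) x]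
    simp [hm]

/-- `B_{m,ψ} = lim F⁻¹ ∑_{a = 1}^F ψ(a) a ^ m`, along multiples `F` of the modulus of `ψ` that
tend to `0` in `ℂ_p`. -/
theorem tendsto_inv_mul_sum_character {N : ℕ} [NeZero N] (ψ : DirichletCharacter ℂ_[p] N) (m : ℕ)
    {T : ℕ → ℕ} (hT : ∀ n, T n ≠ 0) (hlim : Tendsto (fun n => (T n : ℂ_[p])) atTop (𝓝 0)) :
    Tendsto (fun n => ((N * T n : ℕ) : ℂ_[p])⁻¹ *
      ∑ a ∈ Finset.Icc 1 (N * T n), ψ (a : ZMod N) * (a : ℂ_[p]) ^ m) atTop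
      (𝓝 (generalizedBernoulli p ψ m)) := by
  have hN : (N : ℂ_[p]) ≠ 0 := by exact_mod_cast NeZero.ne N
  have h := (tendsto_finsetSum (Finset.Icc 1 N) fun a _ =>
    (tendsto_inv_mul_sum_add_pow (p := p) ((a : ℚ) / (N : ℚ)) m hT hlim).const_mul
      (ψ (a : ZMod N))).const_mul ((N : ℂ_[p]) ^ ((m : ℤ) - 1))
  refine h.congr fun n => ?_
  rw [Finset.sum_Icc_one_mul, Finset.mul_sum, Finset.mul_sum]
  refine Finset.sum_congr rfl fun a _ => ?_
  rw [zpow_sub_one₀ hN, zpow_natCast, Finset.mul_sum, Finset.mul_sum, Finset.mul_sum,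
    Finset.mul_sum]
  refine Finset.sum_congr rfl fun t _ => ?_
  have e1 : ((a + N * t : ℕ) : ZMod N) = a := by simp
  have e2 : ((a + N * t : ℕ) : ℂ_[p]) = N * ((((a : ℚ) / (N : ℚ) : ℚ) : ℂ_[p]) + t) := by
    push_cast
    field_simp
  rw [e1, e2, mul_pow, Nat.cast_mul, mul_inv]
  ring

theorem tendsto_inv_mul_sum_character_prime_pow {N f : ℕ} (hf : f ≠ 0) (hN : N ∣ f * p ^ 2)
    (ψ : DirichletCharacter ℂ_[p] N) (m : ℕ) :
    Tendsto (fun n => ((f * p ^ n : ℕ) : ℂ_[p])⁻¹ *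
      ∑ a ∈ Finset.Icc 1 (f * p ^ n), ψ (a : ZMod N) * (a : ℂ_[p]) ^ m) atTop
      (𝓝 (generalizedBernoulli p ψ m)) := by
  have hp : p ≠ 0 := (Fact.out : p.Prime).ne_zero
  obtain ⟨d, hd⟩ := hN
  have h0 : N * d ≠ 0 := hd ▸ mul_ne_zero hf (pow_ne_zero _ hp)
  have : NeZero N := ⟨left_ne_zero_of_mul h0⟩
  have h := tendsto_inv_mul_sum_character ψ m (T := fun n => d * p ^ n)
    (fun n => mul_ne_zero (right_ne_zero_of_mul h0) (pow_ne_zero _ hp))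
    (PadicComplex.tendsto_mul_prime_pow d)
  rw [← tendsto_add_atTop_iff_nat 2]
  refine h.congr fun n => ?_
  have e : N * (d * p ^ n) = f * p ^ (n + 2) := by
    rw [← mul_assoc, ← hd, pow_add]
    ring
  simp only [e]

/-- Removing the multiples of `p` from the power sums produces the Euler factor at `p`. -/
theorem tendsto_inv_mul_sum_character_not_dvd {N f : ℕ} (hf : f ≠ 0) (hN : N ∣ f * p ^ 2)
    (ψ : DirichletCharacter ℂ_[p] N) (m : ℕ) :
    Tendsto (fun n => ((f * p ^ n : ℕ) : ℂ_[p])⁻¹ *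
      ∑ a ∈ (Finset.Icc 1 (f * p ^ n)).filter (fun a => ¬ p ∣ a),
        ψ (a : ZMod N) * (a : ℂ_[p]) ^ m) atTop
      (𝓝 ((1 - ψ (p : ZMod N) * ((p : ℂ_[p]) ^ m / p)) * generalizedBernoulli p ψ m)) := by
  have hp : p.Prime := Fact.out
  have hp0 : (p : ℂ_[p]) ≠ 0 := by exact_mod_cast hp.ne_zero
  have h := tendsto_inv_mul_sum_character_prime_pow hf hN ψ m
  have h1 := (tendsto_add_atTop_iff_nat 1).2 h
  have h2 := h1.sub (h.const_mul (ψ (p : ZMod N) * ((p : ℂ_[p]) ^ m / p)))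
  rw [← tendsto_add_atTop_iff_nat 1, sub_mul, one_mul]
  refine h2.congr fun n => ?_
  have e : ∑ a ∈ (Finset.Icc 1 (f * p ^ (n + 1))).filter (fun a => p ∣ a),
        ψ (a : ZMod N) * (a : ℂ_[p]) ^ m =
      ∑ a ∈ Finset.Icc 1 (f * p ^ n), ψ (p : ZMod N) * (p : ℂ_[p]) ^ m *
        (ψ (a : ZMod N) * (a : ℂ_[p]) ^ m) := by
    symm
    refine Finset.sum_bij (fun a _ => p * a) (fun a ha => ?_) (fun a _ b _ hab => ?_)
      (fun b hb => ?_) (fun a _ => ?_)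
    · rw [Finset.mem_Icc] at ha
      rw [Finset.mem_filter, Finset.mem_Icc]
      refine ⟨⟨Nat.mul_pos hp.pos ha.1, ?_⟩, dvd_mul_right _ _⟩
      calc p * a ≤ p * (f * p ^ n) := Nat.mul_le_mul_left _ ha.2
        _ = f * p ^ (n + 1) := by ring
    · exact Nat.eq_of_mul_eq_mul_left hp.pos hab
    · rw [Finset.mem_filter, Finset.mem_Icc] at hb
      obtain ⟨⟨hb1, hb2⟩, a, rfl⟩ := hb
      refine ⟨a, Finset.mem_Icc.2 ⟨Nat.pos_of_mul_pos_left hb1, ?_⟩, rfl⟩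
      refine Nat.le_of_mul_le_mul_left (hb2.trans_eq ?_) hp.pos
      ring
    · push_cast
      rw [map_mul]
      ring
  rw [← Finset.sum_filter_add_sum_filter_not (Finset.Icc 1 (f * p ^ (n + 1))) (fun a => p ∣ a), e,
    ← Finset.mul_sum, pow_succ p n]
  push_cast
  have hf0 : (f : ℂ_[p]) ≠ 0 := by exact_mod_cast hf
  field_simp
  ring

end PowerSums

/-! ### Interpolation of moments by Newton series -/

section Interpolation

variable {p : ℕ} [Fact p.Prime]

/-- If the moments `∑ w(a) x(a) ^ m` converge to `l m` and the moments of `x - 1` decay like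
`q ^ (-j)`, then the Newton series of the limits of the latter interpolates `l`. -/
theorem exists_newtonSeries_interpolation (S : ℕ → Finset ℕ) (w : ℕ → ℕ → ℂ_[p])
    (x l : ℕ → ℂ_[p]) (n₀ : ℕ) (C : ℝ)
    (hl : ∀ m, Tendsto (fun n => ∑ a ∈ S n, w n a * x a ^ m) atTop (𝓝 (l m)))
    (hb : ∀ n, n₀ ≤ n → ∀ j, ‖∑ a ∈ S n, w n a * (x a - 1) ^ j‖ ≤ C * ((padicQ p : ℝ)⁻¹) ^ j) :
    ∃ M : ℕ → ℂ_[p],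
      (∀ j, Tendsto (fun n => ∑ a ∈ S n, w n a * (x a - 1) ^ j) atTop (𝓝 (M j))) ∧
      (∀ j, ‖M j‖ ≤ C * ((padicQ p : ℝ)⁻¹) ^ j) ∧
      ∀ m : ℕ, newtonSeries p M (m : ℂ_[p]) = l m := by
  have h1 : ∀ j, Tendsto (fun n => ∑ a ∈ S n, w n a * (x a - 1) ^ j) atTop
      (𝓝 (∑ i ∈ Finset.range (j + 1), (-1) ^ (j - i) * (j.choose i : ℂ_[p]) * l i)) := by
    intro j
    refine (tendsto_finsetSum _ fun i _ => (hl i).const_mul _).congr fun n => ?_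
    simp_rw [Finset.mul_sum]
    rw [Finset.sum_comm]
    refine Finset.sum_congr rfl fun a _ => ?_
    rw [sub_eq_add_neg, add_pow, Finset.mul_sum]
    exact Finset.sum_congr rfl fun i _ => by ring
  refine ⟨_, h1, fun j => ?_, fun m => ?_⟩
  · exact le_of_tendsto (h1 j).norm ((eventually_ge_atTop n₀).mono fun n hn => hb n hn j)
  · rw [newtonSeries_natCast]
    refine tendsto_nhds_unique (tendsto_finsetSum _ fun j _ => (h1 j).const_mul _)
      ((hl m).congr fun n => ?_)
    simp_rw [Finset.mul_sum]
    rw [Finset.sum_comm]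
    refine Finset.sum_congr rfl fun a _ => ?_
    conv_lhs => rw [← sub_add_cancel (x a) 1, add_pow, Finset.mul_sum]
    exact Finset.sum_congr rfl fun i _ => by ring

end Interpolation

/-! ### Power sums of `χ(a)⟨a⟩ ^ m` -/

section AngleSums

variable {p : ℕ} [Fact p.Prime]

/-- The right side is `‖x - y‖ * ρ ^ (j - 1)`, with the exponent `-1` for `j = 0`. -/
theorem norm_pow_sub_pow_le {x y : ℂ_[p]} {ρ : ℝ} (hρ : 0 < ρ) (hx : ‖x‖ ≤ ρ) (hy : ‖y‖ ≤ ρ)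
    (j : ℕ) : ‖x ^ j - y ^ j‖ ≤ ‖x - y‖ * (ρ⁻¹ * ρ ^ j) := by
  rw [← (Commute.all x y).mul_geom_sum₂, norm_mul]
  gcongr
  refine IsUltrametricDist.norm_sum_le_of_forall_le_of_nonneg (by positivity) fun i hi => ?_
  have hi' := Finset.mem_range.1 hi
  rw [norm_mul, norm_pow, norm_pow]
  calc ‖x‖ ^ i * ‖y‖ ^ (j - 1 - i) ≤ ρ ^ i * ρ ^ (j - 1 - i) := by gcongr
    _ = ρ⁻¹ * ρ ^ j := by
      rw [← pow_add]
      obtain ⟨k, rfl⟩ := Nat.exists_eq_succ_of_ne_zero (by omega : j ≠ 0)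
      rw [show i + (k.succ - 1 - i) = k by omega, Nat.succ_eq_add_one, pow_succ]
      field_simp

theorem norm_add_pow_sub_le {y z : ℂ_[p]} (hy : ‖y‖ ≤ 1) (hz : ‖z‖ ≤ 1) (m : ℕ) :
    ‖(y + z) ^ (m + 1) - y ^ (m + 1) - (m + 1) * (y ^ m * z)‖ ≤ ‖z‖ ^ 2 := by
  induction m with
  | zero => simp
  | succ m ih =>
    have e : (y + z) ^ (m + 1 + 1) - y ^ (m + 1 + 1) - ((m + 1 : ℕ) + 1) * (y ^ (m + 1) * z) =
        (y + z) * ((y + z) ^ (m + 1) - y ^ (m + 1) - (m + 1) * (y ^ m * z)) +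
          ((m + 1 : ℕ) : ℂ_[p]) * y ^ m * z ^ 2 := by
      push_cast
      ring
    rw [e]
    refine (IsUltrametricDist.norm_add_le_max _ _).trans (max_le ?_ ?_)
    · rw [norm_mul]
      have h := (IsUltrametricDist.norm_add_le_max y z).trans (max_le hy hz)
      calc _ ≤ 1 * ‖z‖ ^ 2 := by gcongr
        _ = _ := one_mul _
    · rw [norm_mul, norm_mul, norm_pow, norm_pow]
      calc _ ≤ 1 * 1 ^ m * ‖z‖ ^ 2 := by
            gcongr
            exact IsUltrametricDist.norm_natCast_le_one _ _
        _ = _ := by ring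

variable {f : ℕ} [NeZero f] {χ : DirichletCharacter ℂ_[p] f}

/-- The value `(1 - χω⁻ᵐ(p) p ^ (m - 1)) * B_{m,χω⁻ᵐ}`. The power of `p` is written `p ^ m / p`, which
is correct for `m = 0` as well. -/
noncomputable def eulerBernoulli (p : ℕ) [Fact p.Prime] {f : ℕ} (χ : DirichletCharacter ℂ_[p] f)
    (m : ℕ) : ℂ_[p] :=
  (1 - teichmullerTwist p χ m (p : ZMod _) * ((p : ℂ_[p]) ^ m / p)) *
    generalizedBernoulli p (teichmullerTwist p χ m) m

theorem tendsto_inv_mul_sum_angleBracket_pow (hχ : χ.IsPrimitive) (m : ℕ) :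
    Tendsto (fun n => ∑ a ∈ (Finset.Icc 1 (f * p ^ n)).filter (fun a => ¬ p ∣ a),
      ((f * p ^ n : ℕ) : ℂ_[p])⁻¹ * χ (a : ZMod f) * angleBracket p a ^ m) atTop
      (𝓝 (eulerBernoulli p χ m)) := by
  refine (tendsto_inv_mul_sum_character_not_dvd (NeZero.ne f) (conductor_twist_dvd χ m)
    (teichmullerTwist p χ m) m).congr fun n => ?_
  rw [Finset.mul_sum]
  refine Finset.sum_congr rfl fun a ha => ?_
  rw [teichmullerTwist_apply hχ m (Finset.mem_filter.1 ha).2, angleBracket]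
  ring

theorem tendsto_sum_twist_mul_angleBracket_pow (hχ : χ.IsPrimitive) (m : ℕ) :
    Tendsto (fun n => ∑ a ∈ (Finset.Icc 1 (f * p ^ n)).filter (fun a => ¬ p ∣ a),
      teichmullerTwist p χ 1 (a : ZMod _) * angleBracket p a ^ m) atTop (𝓝 0) := by
  have h := (PadicComplex.tendsto_mul_prime_pow (p := p) f).mul
    (tendsto_inv_mul_sum_character_not_dvd (NeZero.ne f) (conductor_twist_dvd χ (m + 1))
      (teichmullerTwist p χ (m + 1)) m)
  rw [zero_mul] at h
  refine h.congr fun n => ?_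
  have h0 : ((f * p ^ n : ℕ) : ℂ_[p]) ≠ 0 := by
    exact_mod_cast mul_ne_zero (NeZero.ne f) (pow_ne_zero n (Fact.out : p.Prime).ne_zero)
  rw [mul_inv_cancel_left₀ h0]
  refine Finset.sum_congr rfl fun a ha => ?_
  rw [teichmullerTwist_apply hχ _ (Finset.mem_filter.1 ha).2,
    teichmullerTwist_apply hχ _ (Finset.mem_filter.1 ha).2, angleBracket]
  ring

theorem padicQ_dvd_mul_prime_pow (p f : ℕ) {n : ℕ} (hn : 2 ≤ n) : padicQ p ∣ f * p ^ n :=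
  ((padicQ_dvd_sq p).trans (pow_dvd_pow p hn)).trans (dvd_mul_left _ _)

theorem sum_filter_not_dvd_mul_prime {F : ℕ} (hF : p ∣ F) (h : ℕ → ℂ_[p]) :
    ∑ b ∈ (Finset.Icc 1 (F * p)).filter (fun b => ¬ p ∣ b), h b =
      ∑ a ∈ (Finset.Icc 1 F).filter (fun a => ¬ p ∣ a), ∑ t ∈ Finset.range p, h (a + F * t) := by
  rw [Finset.sum_filter, Finset.sum_Icc_one_mul, Finset.sum_filter]
  refine Finset.sum_congr rfl fun a _ => ?_
  have e : ∀ t, p ∣ a + F * t ↔ p ∣ a := fun t =>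
    Nat.dvd_add_iff_left (hF.mul_right t) |>.symm
  simp only [e]
  split_ifs <;> simp

/-- The normalized moments `F⁻¹ ∑ χ(a) (⟨a⟩ - 1) ^ j` decay like `q ^ (-j)`, uniformly in
`F = f p ^ n`. The passage from `F` to `F p` replaces `⟨a⟩` by `⟨a⟩ + F t / ω(a)`, which changes
`(⟨a⟩ - 1) ^ j` by at most `|F| q ^ (1 - j)`. -/
theorem norm_inv_mul_sum_le (χ : DirichletCharacter ℂ_[p] f) {n : ℕ} (hn : 2 ≤ n) (j : ℕ) :
    ‖∑ a ∈ (Finset.Icc 1 (f * p ^ n)).filter (fun a => ¬ p ∣ a),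
      ((f * p ^ n : ℕ) : ℂ_[p])⁻¹ * χ (a : ZMod f) * (angleBracket p a - 1) ^ j‖ ≤
      max ((p : ℝ) * padicQ p) ‖((f * p ^ 2 : ℕ) : ℂ_[p])⁻¹‖ * ((padicQ p : ℝ)⁻¹) ^ j := by
  have hp : p.Prime := Fact.out
  have hp0 : (p : ℂ_[p]) ≠ 0 := by exact_mod_cast hp.ne_zero
  have hq : (0 : ℝ) < (padicQ p : ℝ)⁻¹ := by
    have := padicQ_pos p
    positivity
  induction n, hn using Nat.le_induction with
  | base =>
    refine IsUltrametricDist.norm_sum_le_of_forall_le_of_nonneg (by positivity) fun a ha => ?_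
    have h1 := norm_sub_one_pow_le (norm_angleBracket_sub_one_le (Finset.mem_filter.1 ha).2) j
    rw [one_mul] at h1
    rw [norm_mul, norm_mul]
    gcongr
    calc _ ≤ ‖((f * p ^ 2 : ℕ) : ℂ_[p])⁻¹‖ * 1 := by
          gcongr
          exact DirichletCharacter.norm_le_one χ _
      _ ≤ _ := by rw [mul_one]; exact le_max_right _ _
  | succ n hn ih =>
    set F := f * p ^ n with hF
    have hqF : padicQ p ∣ F := padicQ_dvd_mul_prime_pow p f hn
    have hF0 : (F : ℂ_[p]) ≠ 0 := by
      exact_mod_cast mul_ne_zero (NeZero.ne f) (pow_ne_zero n hp.ne_zero)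
    have hFp : f * p ^ (n + 1) = F * p := by rw [pow_succ, ← mul_assoc]
    rw [hFp, sum_filter_not_dvd_mul_prime ((dvd_padicQ p).trans hqF)]
    have e : ∑ a ∈ (Finset.Icc 1 F).filter (fun a => ¬ p ∣ a), ∑ t ∈ Finset.range p,
          ((F * p : ℕ) : ℂ_[p])⁻¹ * χ ((a + F * t : ℕ) : ZMod f) *
            (angleBracket p (a + F * t) - 1) ^ j =
        ∑ a ∈ (Finset.Icc 1 F).filter (fun a => ¬ p ∣ a),
          (F : ℂ_[p])⁻¹ * χ (a : ZMod f) * (angleBracket p a - 1) ^ j +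
        ∑ a ∈ (Finset.Icc 1 F).filter (fun a => ¬ p ∣ a), ∑ t ∈ Finset.range p,
          ((F * p : ℕ) : ℂ_[p])⁻¹ * χ (a : ZMod f) *
            ((angleBracket p (a + F * t) - 1) ^ j - (angleBracket p a - 1) ^ j) := by
      rw [← Finset.sum_add_distrib]
      refine Finset.sum_congr rfl fun a _ => ?_
      have e1 : ∀ t : ℕ, ((a + F * t : ℕ) : ZMod f) = a := fun t => by simp [hF]
      have e2 : (F : ℂ_[p])⁻¹ * χ (a : ZMod f) * (angleBracket p a - 1) ^ j =
          ∑ t ∈ Finset.range p, ((F * p : ℕ) : ℂ_[p])⁻¹ * χ (a : ZMod f) *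
            (angleBracket p a - 1) ^ j := by
        rw [Finset.sum_const, Finset.card_range, nsmul_eq_mul]
        push_cast
        field_simp
      rw [e2, ← Finset.sum_add_distrib]
      exact Finset.sum_congr rfl fun t _ => by rw [e1]; ring
    rw [e]
    refine (IsUltrametricDist.norm_add_le_max _ _).trans (max_le ih ?_)
    refine IsUltrametricDist.norm_sum_le_of_forall_le_of_nonneg (by positivity) fun a ha => ?_
    refine IsUltrametricDist.norm_sum_le_of_forall_le_of_nonneg (by positivity) fun t _ => ?_
    have hpa := (Finset.mem_filter.1 ha).2
    have hpat : ¬ p ∣ a + F * t := fun h => hpa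
      ((Nat.dvd_add_iff_left ((((dvd_padicQ p).trans hqF)).mul_right t)).2 h)
    have h1 := norm_pow_sub_pow_le hq (norm_angleBracket_sub_one_le hpat)
      (norm_angleBracket_sub_one_le hpa) j
    have h2 : ‖angleBracket p (a + F * t) - 1 - (angleBracket p a - 1)‖ ≤ ‖(F : ℂ_[p])‖ := by
      rw [angleBracket_add_mul hqF, sub_sub_sub_cancel_right, add_sub_cancel_left, norm_mul,
        norm_div, norm_teichmullerCharacter hpa, div_one]
      exact mul_le_of_le_one_right (norm_nonneg _) (IsUltrametricDist.norm_natCast_le_one _ _)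
    rw [norm_mul, norm_mul, norm_inv, Nat.cast_mul, norm_mul, PadicComplex.norm_prime]
    have hF1 : 0 < ‖(F : ℂ_[p])‖ := norm_pos_iff.2 hF0
    have hp1 : (0 : ℝ) < p := by exact_mod_cast hp.pos
    calc _ ≤ (‖(F : ℂ_[p])‖ * (p : ℝ)⁻¹)⁻¹ * 1 *
          (‖(F : ℂ_[p])‖ * (((padicQ p : ℝ)⁻¹)⁻¹ * ((padicQ p : ℝ)⁻¹) ^ j)) := by
          gcongr
          · exact DirichletCharacter.norm_le_one χ _
          · exact h1.trans (by gcongr)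
      _ = (p * padicQ p) * ((padicQ p : ℝ)⁻¹) ^ j := by
          rw [inv_inv]
          field_simp
      _ ≤ _ := by
          gcongr
          exact le_max_left _ _

end AngleSums

/-! ### The numbers `ε_{a,c,F}` and the permutation `a ↦ c⁻¹a` of the residues modulo `F` -/

section Eps

/-- The residue `k = {-a F⁻¹}_c`, characterized by `0 ≤ k < c` and `c ∣ a + F k`. -/
def residueShift (c F a : ℕ) : ℕ := (-((a : ℤ) : ZMod c) * (F : ZMod c)⁻¹).val

theorem residueShift_lt {c : ℕ} (hc : 0 < c) (F a : ℕ) : residueShift c F a < c :=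
  have : NeZero c := ⟨hc.ne'⟩
  ZMod.val_lt _

theorem dvd_add_mul_residueShift {c F : ℕ} (hc : 0 < c) (hF : F.Coprime c) (a : ℕ) :
    c ∣ a + F * residueShift c F a := by
  have : NeZero c := ⟨hc.ne'⟩
  rw [← ZMod.natCast_eq_zero_iff, Nat.cast_add, Nat.cast_mul, residueShift, ZMod.natCast_val,
    ZMod.cast_id', id_eq, mul_left_comm, ZMod.coe_mul_inv_eq_one F hF, Int.cast_natCast]
  ring

/-- The map `a ↦ (a + F k) / c`, with `k = {-a F⁻¹}_c`, is division by `c` on the residues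
modulo `F`, represented by the integers `1, …, F`. -/
theorem sum_residueShift_div {M : Type*} [AddCommMonoid M] {p c F : ℕ} (hc : 0 < c)
    (hF : F.Coprime c) (hp : p ∣ F) (h : ℕ → M) :
    ∑ a ∈ (Finset.Icc 1 F).filter (fun a => ¬ p ∣ a), h ((a + F * residueShift c F a) / c) =
      ∑ a ∈ (Finset.Icc 1 F).filter (fun a => ¬ p ∣ a), h a := by
  set S := (Finset.Icc 1 F).filter (fun a => ¬ p ∣ a) with hS
  have hmul : ∀ a, c * ((a + F * residueShift c F a) / c) = a + F * residueShift c F a := fun a =>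
    Nat.mul_div_cancel' (dvd_add_mul_residueShift hc hF a)
  have hmaps : ∀ a ∈ S, (a + F * residueShift c F a) / c ∈ S := by
    intro a ha
    rw [hS, Finset.mem_filter, Finset.mem_Icc] at ha ⊢
    obtain ⟨⟨h1, h2⟩, h3⟩ := ha
    have hk := residueShift_lt hc F a
    have hm := hmul a
    refine ⟨⟨Nat.pos_of_ne_zero fun h0 => ?_, ?_⟩, fun hdvd => h3 ?_⟩
    · rw [h0] at hm
      omega
    · refine Nat.le_of_mul_le_mul_left ?_ hc
      rw [hm]
      nlinarith [Nat.mul_le_mul_left F (Nat.succ_le_of_lt hk)]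
    · rw [Nat.dvd_add_iff_left (hp.mul_right (residueShift c F a)), ← hm]
      exact hdvd.mul_left c
  have hinj : Set.InjOn (fun a => (a + F * residueShift c F a) / c) S := by
    intro a ha b hb hab
    simp only [hS, Finset.coe_filter, Finset.mem_Icc, Set.mem_ofPred_eq] at ha hb
    have e : a + F * residueShift c F a = b + F * residueShift c F b := by
      rw [← hmul a, ← hmul b]
      exact congrArg (c * ·) hab
    have hmod : a ≡ b [MOD F] := by
      have := congrArg (· % F) e
      simpa [Nat.ModEq] using this
    rcases le_total a b with hle | hle
    · have hd := (Nat.modEq_iff_dvd' hle).1 hmod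
      have := Nat.eq_zero_of_dvd_of_lt hd (by omega)
      omega
    · have hd := (Nat.modEq_iff_dvd' hle).1 hmod.symm
      have := Nat.eq_zero_of_dvd_of_lt hd (by omega)
      omega
  refine Finset.sum_bij (fun a _ => (a + F * residueShift c F a) / c) hmaps
    (fun a ha b hb hab => hinj ha hb hab) (fun b hb => ?_) fun _ _ => rfl
  obtain ⟨a, ha, hab⟩ := Finset.surjOn_of_injOn_of_card_le _ hmaps hinj le_rfl hb
  exact ⟨a, ha, hab⟩

variable {p : ℕ} [Fact p.Prime]

theorem cast_dirichletEps (c F a : ℕ) :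
    ((dirichletEps (a : ℤ) c F : ℚ) : ℂ_[p]) =
      ((c : ℂ_[p]) - 1) / 2 - (residueShift c F a : ℕ) := by
  simp [dirichletEps, residueShift]

theorem norm_dirichletEps_le_one {c : ℕ} (hpc : ¬ p ∣ c) (F a : ℕ) :
    ‖((dirichletEps (a : ℤ) c F : ℚ) : ℂ_[p])‖ ≤ 1 := by
  rw [cast_dirichletEps, sub_eq_add_neg]
  refine (IsUltrametricDist.norm_add_le_max _ _).trans (max_le ?_ ?_)
  · by_cases h2 : p = 2
    · subst h2
      -- `c` is odd, so that `(c - 1) / 2` is an integer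
      obtain ⟨d, rfl⟩ : ∃ d, c = 2 * d + 1 := ⟨c / 2, by omega⟩
      have : (((2 * d + 1 : ℕ) : ℂ_[2]) - 1) / 2 = (d : ℂ_[2]) := by
        push_cast
        ring
      rw [this]
      exact IsUltrametricDist.norm_natCast_le_one _ _
    · have h2' : ‖((2 : ℕ) : ℂ_[p])‖ = 1 := PadicComplex.norm_natCast_of_not_dvd fun h =>
        h2 ((Nat.prime_dvd_prime_iff_eq Fact.out Nat.prime_two).1 h)
      rw [Nat.cast_ofNat] at h2'
      rw [norm_div, h2', div_one]
      have := IsUltrametricDist.norm_intCast_le_one ℂ_[p] ((c : ℤ) - 1)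
      simpa using this
  · rw [norm_neg]
    exact IsUltrametricDist.norm_natCast_le_one _ _

variable {f : ℕ} [NeZero f] {χ : DirichletCharacter ℂ_[p] f}

/-- Expanding `⟨c⟩⟨a'⟩ = ⟨a⟩ + F k / ω(a)`, where `c a' = a + F k`, to first order in `F` expresses
the moments of `k` through the power sums of `χ(a)⟨a⟩ ^ m`. -/
theorem norm_sum_sub_sum_residueShift_le (hχ : χ.IsPrimitive) {c : ℕ} (hc : 0 < c)
    (hcop : c.Coprime (p * f)) (m : ℕ) {n : ℕ} (hn : 2 ≤ n) :
    ‖(χ (c : ZMod f) * angleBracket p c ^ (m + 1) - 1) *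
        ∑ a ∈ (Finset.Icc 1 (f * p ^ n)).filter (fun a => ¬ p ∣ a),
          ((f * p ^ n : ℕ) : ℂ_[p])⁻¹ * χ (a : ZMod f) * angleBracket p a ^ (m + 1) -
      (m + 1) * ∑ a ∈ (Finset.Icc 1 (f * p ^ n)).filter (fun a => ¬ p ∣ a),
          teichmullerTwist p χ 1 (a : ZMod _) * residueShift c (f * p ^ n) a *
            angleBracket p a ^ m‖ ≤ ‖((f * p ^ n : ℕ) : ℂ_[p])‖ := by
  have hp : p.Prime := Fact.out
  have hFc : (f * p ^ n).Coprime c := by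
    refine Nat.Coprime.mul_left ?_ (Nat.Coprime.pow_left n ?_)
    · exact (hcop.coprime_dvd_right (dvd_mul_left f p)).symm
    · exact (hcop.coprime_dvd_right (dvd_mul_right p f)).symm
  set F := f * p ^ n with hF
  set S := (Finset.Icc 1 F).filter (fun a => ¬ p ∣ a) with hS
  have hqF : padicQ p ∣ F := padicQ_dvd_mul_prime_pow p f hn
  have hpF : p ∣ F := (dvd_padicQ p).trans hqF
  have hF0 : (F : ℂ_[p]) ≠ 0 := by
    exact_mod_cast mul_ne_zero (NeZero.ne f) (pow_ne_zero n hp.ne_zero)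
  have e1 : χ (c : ZMod f) * angleBracket p c ^ (m + 1) *
      ∑ a ∈ S, (F : ℂ_[p])⁻¹ * χ (a : ZMod f) * angleBracket p a ^ (m + 1) =
      ∑ a ∈ S, (F : ℂ_[p])⁻¹ * χ (a : ZMod f) *
        angleBracket p (a + F * residueShift c F a) ^ (m + 1) := by
    rw [← sum_residueShift_div hc hFc hpF
      (fun a => (F : ℂ_[p])⁻¹ * χ (a : ZMod f) * angleBracket p a ^ (m + 1)), Finset.mul_sum]
    refine Finset.sum_congr rfl fun a _ => ?_
    have h1 := Nat.mul_div_cancel' (dvd_add_mul_residueShift hc hFc a)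
    have h2 : χ (c : ZMod f) * χ (((a + F * residueShift c F a) / c : ℕ) : ZMod f) =
        χ (a : ZMod f) := by
      rw [← map_mul, ← Nat.cast_mul, h1]
      simp [hF]
    rw [← h2]
    conv_rhs => rw [← h1, angleBracket_mul, h1]
    ring
  rw [sub_mul, e1, one_mul, Finset.mul_sum, ← Finset.sum_sub_distrib, ← Finset.sum_sub_distrib]
  refine IsUltrametricDist.norm_sum_le_of_forall_le_of_nonneg (norm_nonneg _) fun a ha => ?_
  have hpa := (Finset.mem_filter.1 ha).2
  set z : ℂ_[p] := F * (residueShift c F a / teichmullerCharacter p (a : ZMod (padicQ p))) with hz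
  have hzF : ‖z‖ ≤ ‖(F : ℂ_[p])‖ := by
    rw [hz, norm_mul, norm_div, norm_teichmullerCharacter hpa, div_one]
    exact mul_le_of_le_one_right (norm_nonneg _) (IsUltrametricDist.norm_natCast_le_one _ _)
  have hmain := norm_add_pow_sub_le (norm_angleBracket hpa).le
    (hzF.trans (IsUltrametricDist.norm_natCast_le_one _ _)) m
  have e2 : (F : ℂ_[p])⁻¹ * χ (a : ZMod f) *
        angleBracket p (a + F * residueShift c F a) ^ (m + 1) -
      (F : ℂ_[p])⁻¹ * χ (a : ZMod f) * angleBracket p a ^ (m + 1) -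
      (m + 1) * (teichmullerTwist p χ 1 (a : ZMod _) * residueShift c F a *
        angleBracket p a ^ m) =
      (F : ℂ_[p])⁻¹ * χ (a : ZMod f) * ((angleBracket p a + z) ^ (m + 1) -
        angleBracket p a ^ (m + 1) - (m + 1) * (angleBracket p a ^ m * z)) := by
    rw [teichmullerTwist_apply hχ 1 hpa, angleBracket_add_mul hqF, ← hz]
    have : (F : ℂ_[p])⁻¹ * z =
        residueShift c F a / teichmullerCharacter p (a : ZMod (padicQ p)) := by
      rw [hz, inv_mul_cancel_left₀ hF0]
    linear_combination (-(m + 1) * χ (a : ZMod f) * angleBracket p a ^ m) * (-this)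
  rw [e2, norm_mul, norm_mul, norm_inv]
  calc _ ≤ ‖(F : ℂ_[p])‖⁻¹ * 1 * ‖(F : ℂ_[p])‖ ^ 2 := by
        gcongr
        · exact DirichletCharacter.norm_le_one χ _
        · exact hmain.trans (by gcongr)
    _ = ‖(F : ℂ_[p])‖ := by
        have := norm_ne_zero_iff.2 hF0
        field_simp

theorem tendsto_sum_dirichletEps_mul_pow (hχ : χ.IsPrimitive) {c : ℕ} (hc : 0 < c)
    (hcop : c.Coprime (p * f)) (m : ℕ) :
    Tendsto (fun n => ∑ a ∈ (Finset.Icc 1 (f * p ^ n)).filter (fun a => ¬ p ∣ a),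
      teichmullerTwist p χ 1 (a : ZMod _) *
        ((dirichletEps (a : ℤ) c (f * p ^ n) : ℚ) : ℂ_[p]) * angleBracket p a ^ m) atTop
      (𝓝 ((1 - χ (c : ZMod f) * angleBracket p c ^ (m + 1)) *
        (eulerBernoulli p χ (m + 1) / (m + 1)))) := by
  have hm : ((m : ℂ_[p]) + 1) ≠ 0 := by exact_mod_cast m.succ_ne_zero
  have h1 := (tendsto_sum_twist_mul_angleBracket_pow (p := p) hχ m).const_mul
    (((c : ℂ_[p]) - 1) / 2)
  have h2 := (tendsto_inv_mul_sum_angleBracket_pow (p := p) hχ (m + 1)).const_mul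
    (χ (c : ZMod f) * angleBracket p c ^ (m + 1) - 1)
  have h3 := squeeze_zero_norm' ((eventually_ge_atTop 2).mono fun n hn =>
    norm_sum_sub_sum_residueShift_le hχ hc hcop m hn)
    (by simpa using (PadicComplex.tendsto_mul_prime_pow (p := p) f).norm)
  have h4 := h1.sub ((h2.sub h3).const_mul ((m : ℂ_[p]) + 1)⁻¹)
  refine (h4.congr fun n => ?_).trans_eq (congrArg 𝓝 ?_)
  · rw [sub_sub_cancel, inv_mul_cancel_left₀ hm, Finset.mul_sum, ← Finset.sum_sub_distrib]
    refine Finset.sum_congr rfl fun a _ => ?_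
    rw [cast_dirichletEps]
    ring
  · field_simp
    ring

end Eps

/-! ### Existence of the `p`-adic `L`-function -/

section Existence

variable {p : ℕ} [Fact p.Prime]

theorem norm_one_sub_natCast_lt (p : ℕ) [Fact p.Prime] (m : ℕ) :
    ‖1 - (m : ℂ_[p])‖ < padicLRadius p := by
  have h := IsUltrametricDist.norm_intCast_le_one ℂ_[p] (1 - (m : ℤ))
  push_cast at h
  exact h.trans_lt (one_lt_padicLRadius p)

theorem generalizedBernoulli_zero_of_ne_one {f : ℕ} [NeZero f] {χ : DirichletCharacter ℂ_[p] f}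
    (hχ : χ ≠ 1) : generalizedBernoulli p χ 0 = 0 := by
  have hinj : Set.InjOn (fun a : ℕ => (a : ZMod f)) (Finset.Icc 1 f) := by
    intro a ha b hb hab
    rw [Finset.coe_Icc, Set.mem_Icc] at ha hb
    have hmod := (ZMod.natCast_eq_natCast_iff a b f).1 hab
    rcases le_total a b with hle | hle
    · have := Nat.eq_zero_of_dvd_of_lt ((Nat.modEq_iff_dvd' hle).1 hmod) (by omega)
      omega
    · have := Nat.eq_zero_of_dvd_of_lt ((Nat.modEq_iff_dvd' hle).1 hmod.symm) (by omega)
      omega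
  have hsum : ∑ a ∈ Finset.Icc 1 f, χ (a : ZMod f) = ∑ x, χ x :=
    Finset.sum_nbij (fun a : ℕ => (a : ZMod f)) (fun _ _ => Finset.mem_univ _) hinj
      (Finset.surjOn_of_injOn_of_card_le _ (fun _ _ => Finset.mem_univ _) hinj
        (by simp [ZMod.card])) fun _ _ => rfl
  simp [generalizedBernoulli, hsum, MulChar.sum_eq_zero_of_ne_one hχ]

theorem neg_eulerBernoulli_div {f : ℕ} {χ : DirichletCharacter ℂ_[p] f} {m : ℕ}
    (hm : 1 ≤ m) :
    -(1 - teichmullerTwist p χ m (p : ZMod _) * (p : ℂ_[p]) ^ (m - 1)) *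
        (generalizedBernoulli p (teichmullerTwist p χ m) m / (m : ℂ_[p])) =
      -eulerBernoulli p χ m / m := by
  have hp0 : (p : ℂ_[p]) ≠ 0 := by exact_mod_cast (Fact.out : p.Prime).ne_zero
  rw [eulerBernoulli, pow_sub₀ _ hp0 hm, pow_one]
  ring

variable {f : ℕ} [NeZero f] {χ : DirichletCharacter ℂ_[p] f}

theorem eulerBernoulli_zero_of_ne_one (hprim : χ.IsPrimitive) (hχ : χ ≠ 1) :
    eulerBernoulli p χ 0 = 0 := by
  have h := tendsto_inv_mul_sum_character_not_dvd (NeZero.ne f) (dvd_mul_right f (p ^ 2)) χ 0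
  rw [generalizedBernoulli_zero_of_ne_one hχ, mul_zero] at h
  refine tendsto_nhds_unique (tendsto_inv_mul_sum_angleBracket_pow hprim 0) (h.congr fun n => ?_)
  rw [Finset.mul_sum]
  exact Finset.sum_congr rfl fun a _ => by ring

/-- The function `(s - 1) * L_p(s, χ)`, as the Newton series in `1 - s` of the limits of
`F⁻¹ ∑ χ(a) (⟨a⟩ - 1) ^ j`. -/
theorem exists_isAnalyticOnDisc_eulerBernoulli (hprim : χ.IsPrimitive) :
    ∃ g, IsAnalyticOnDisc p (padicLRadius p) g ∧
      ∀ m : ℕ, g (1 - (m : ℂ_[p])) = eulerBernoulli p χ m := by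
  obtain ⟨V, -, hV, hint⟩ := exists_newtonSeries_interpolation
    (fun n => (Finset.Icc 1 (f * p ^ n)).filter (fun a => ¬ p ∣ a))
    (fun n a => ((f * p ^ n : ℕ) : ℂ_[p])⁻¹ * χ (a : ZMod f)) (angleBracket p)
    (eulerBernoulli p χ) 2 _ (tendsto_inv_mul_sum_angleBracket_pow hprim)
    (fun n hn j => norm_inv_mul_sum_le χ hn j)
  refine ⟨fun s => newtonSeries p V (((1 : ℤ) : ℂ_[p]) - s), isAnalyticOnDisc_newtonSeries hV 1,
    fun m => ?_⟩
  show newtonSeries p V (((1 : ℤ) : ℂ_[p]) - (1 - (m : ℂ_[p]))) = _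
  rw [Int.cast_one, sub_sub_cancel, hint]

theorem exists_isPadicLFunction (hprim : χ.IsPrimitive) : ∃ L, IsPadicLFunction p χ L := by
  obtain ⟨g, hg, hint⟩ := exists_isAnalyticOnDisc_eulerBernoulli hprim
  have key : ∀ L : ℂ_[p] → ℂ_[p],
      (∀ s, ‖s‖ < padicLRadius p → s ≠ 1 → L s = g s / (s - 1)) →
      (χ ≠ 1 → IsAnalyticOnDisc p (padicLRadius p) L) → IsPadicLFunction p χ L := by
    refine fun L hL han => ⟨⟨g, hg, hL⟩, han, fun m hm => ?_⟩
    have hm0 : (m : ℂ_[p]) ≠ 0 := by exact_mod_cast (by omega : m ≠ 0)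
    rw [hL _ (norm_one_sub_natCast_lt p m) (by simpa using hm0), hint, neg_eulerBernoulli_div hm,
      sub_sub_cancel_left, div_neg, neg_div]
  by_cases hχ : χ = 1
  · exact ⟨fun s => g s / (s - 1), key _ (fun _ _ _ => rfl) fun h => absurd hχ h⟩
  · have hg1 : g 1 = 0 := by
      have := hint 0
      rwa [Nat.cast_zero, sub_zero, eulerBernoulli_zero_of_ne_one hprim hχ] at this
    obtain ⟨L, hL, hgL⟩ := hg.exists_eq_sub_one_mul (one_lt_padicLRadius p) hg1
    refine ⟨L, key L (fun s hs hs1 => ?_) fun _ => hL⟩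
    rw [hgL s hs, mul_div_cancel_left₀ _ (sub_ne_zero.2 hs1)]

theorem isPadicLFunction_padicLFunction (hprim : χ.IsPrimitive) :
    IsPadicLFunction p χ (padicLFunction p χ) :=
  Classical.epsilon_spec (exists_isPadicLFunction hprim)

end Existence

/-! ### The limit of the sums -/

section Limit

variable {p : ℕ} [Fact p.Prime] {f : ℕ} {χ : DirichletCharacter ℂ_[p] f}

theorem padicDirichletSum_eq_newtonSeries (c F : ℕ) {s : ℂ_[p]}
    (hs : ‖s‖ < padicLRadius p) :
    padicDirichletSum p χ c F s =
      newtonSeries p (fun j => ∑ a ∈ (Finset.Icc 1 F).filter (fun a => ¬ p ∣ a),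
        teichmullerTwist p χ 1 (a : ZMod _) * ((dirichletEps (a : ℤ) c F : ℚ) : ℂ_[p]) *
          (angleBracket p a - 1) ^ j) (-s) := by
  have hs' : ‖-s‖ < padicLRadius p := by rwa [norm_neg]
  have h := hasSum_sum (s := (Finset.Icc 1 F).filter (fun a => ¬ p ∣ a)) fun a ha =>
    (hasSum_newtonSeries (norm_sub_one_pow_le
      (norm_angleBracket_sub_one_le (Finset.mem_filter.1 ha).2)) hs').mul_left
      (teichmullerTwist p χ 1 (a : ZMod _) * ((dirichletEps (a : ℤ) c F : ℚ) : ℂ_[p]))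
  have e : padicDirichletSum p χ c F s = ∑ a ∈ (Finset.Icc 1 F).filter (fun a => ¬ p ∣ a),
      teichmullerTwist p χ 1 (a : ZMod _) * ((dirichletEps (a : ℤ) c F : ℚ) : ℂ_[p]) *
        newtonSeries p (fun j => (angleBracket p a - 1) ^ j) (-s) := by
    refine Finset.sum_congr rfl fun a ha => ?_
    rw [div_eq_mul_inv,
      inv_padicPow (norm_angleBracket_sub_one_le (Finset.mem_filter.1 ha).2) hs]
    rfl
  rw [e, ← h.tsum_eq]
  refine tsum_congr fun j => ?_
  rw [Finset.mul_sum]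
  exact Finset.sum_congr rfl fun a _ => by ring

theorem norm_sum_dirichletEps_le {c : ℕ} (hpc : ¬ p ∣ c) (F j : ℕ) :
    ‖∑ a ∈ (Finset.Icc 1 F).filter (fun a => ¬ p ∣ a),
        teichmullerTwist p χ 1 (a : ZMod _) * ((dirichletEps (a : ℤ) c F : ℚ) : ℂ_[p]) *
          (angleBracket p a - 1) ^ j‖ ≤ 1 * ((padicQ p : ℝ)⁻¹) ^ j := by
  refine IsUltrametricDist.norm_sum_le_of_forall_le_of_nonneg (by positivity) fun a ha => ?_
  rw [norm_mul, norm_mul]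
  refine mul_le_mul ?_ ((norm_sub_one_pow_le
    (norm_angleBracket_sub_one_le (Finset.mem_filter.1 ha).2) j).trans_eq (one_mul _))
    (norm_nonneg _) zero_le_one
  exact mul_le_one₀ (DirichletCharacter.norm_le_one _ _) (norm_nonneg _)
    (norm_dirichletEps_le_one hpc F a)

/-- The sums converge on the whole disc to a Newton series in `-s`, whose values at the points
`s = 1 - m` are computed from generalized Bernoulli numbers. -/
theorem exists_tendsto_padicDirichletSum [NeZero f] (hprim : χ.IsPrimitive) {c : ℕ} (hc : 0 < c)
    (hcop : c.Coprime (p * f)) :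
    ∃ M : ℕ → ℂ_[p], (∀ j, ‖M j‖ ≤ 1 * ((padicQ p : ℝ)⁻¹) ^ j) ∧
      (∀ s, ‖s‖ < padicLRadius p → Tendsto (fun n => padicDirichletSum p χ c (f * p ^ n) s) atTop
        (𝓝 (newtonSeries p M (-s)))) ∧
      ∀ m : ℕ, 1 ≤ m → newtonSeries p M (-(1 - (m : ℂ_[p]))) =
        (1 - χ (c : ZMod f) * angleBracket p c ^ m) * (eulerBernoulli p χ m / m) := by
  have hpc : ¬ p ∣ c := (Nat.Prime.coprime_iff_not_dvd Fact.out).1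
    (hcop.coprime_dvd_right (dvd_mul_right p f)).symm
  obtain ⟨M, hlim, hM, hint⟩ := exists_newtonSeries_interpolation
    (fun n => (Finset.Icc 1 (f * p ^ n)).filter (fun a => ¬ p ∣ a))
    (fun n a => teichmullerTwist p χ 1 (a : ZMod _) *
      ((dirichletEps (a : ℤ) c (f * p ^ n) : ℚ) : ℂ_[p])) (angleBracket p)
    _ 0 1 (tendsto_sum_dirichletEps_mul_pow hprim hc hcop)
    (fun n _ j => norm_sum_dirichletEps_le hpc _ j)
  refine ⟨M, hM, fun s hs => ?_, fun m hm => ?_⟩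
  · simp only [padicDirichletSum_eq_newtonSeries c _ hs]
    exact tendsto_newtonSeries (n₀ := 0) (fun n _ j => norm_sum_dirichletEps_le hpc _ j) hlim
      (by rwa [norm_neg])
  · obtain ⟨k, rfl⟩ := Nat.exists_eq_succ_of_ne_zero (by omega : m ≠ 0)
    have e : -(1 - ((k.succ : ℕ) : ℂ_[p])) = (k : ℂ_[p]) := by
      push_cast
      ring
    rw [e, hint, Nat.succ_eq_add_one, Nat.cast_succ]

theorem isAnalyticOnDisc_one_sub_mul_padicPow (u : ℂ_[p]) {x : ℂ_[p]}
    (hx : ‖x - 1‖ ≤ (padicQ p : ℝ)⁻¹) :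
    IsAnalyticOnDisc p (padicLRadius p) (fun s => 1 - u * padicPow p x (1 - s)) := by
  have h := (isAnalyticOnDisc_polynomial (r := padicLRadius p) (1 : Polynomial ℂ_[p])).sub
    ((isAnalyticOnDisc_newtonSeries (norm_sub_one_pow_le hx) 1).const_mul u)
  simp only [Polynomial.eval_one, Int.cast_one] at h
  exact h

theorem padicPow_one_sub_one_sub_natCast (x : ℂ_[p]) (m : ℕ) :
    padicPow p x (1 - (1 - (m : ℂ_[p]))) = x ^ m := by
  rw [sub_sub_cancel, padicPow_natCast]

/-- A Newton series with the values of `-(1 - χ(c)⟨c⟩ ^ (1 - s)) * L(s)` at the points `s = 1 - m`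
equals this function on the whole disc. -/
theorem IsPadicLFunction.newtonSeries_eq {L : ℂ_[p] → ℂ_[p]} (hL : IsPadicLFunction p χ L) {c : ℕ}
    (hpc : ¬ p ∣ c) {M : ℕ → ℂ_[p]} (hM : ∀ j, ‖M j‖ ≤ 1 * ((padicQ p : ℝ)⁻¹) ^ j)
    (hint : ∀ m : ℕ, 1 ≤ m → newtonSeries p M (-(1 - (m : ℂ_[p]))) =
        (1 - χ (c : ZMod f) * angleBracket p c ^ m) * (eulerBernoulli p χ m / m))
    {s : ℂ_[p]} (hs : ‖s‖ < padicLRadius p) (hs1 : χ = 1 → s ≠ 1) :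
    newtonSeries p M (-s) =
      -(1 - χ (c : ZMod f) * padicPow p (angleBracket p c) (1 - s)) * L s := by
  have hR := one_lt_padicLRadius p
  have hI : IsAnalyticOnDisc p (padicLRadius p) (fun s => newtonSeries p M (-s)) := by
    have h := isAnalyticOnDisc_newtonSeries hM 0
    simp only [Int.cast_zero, zero_sub] at h
    exact h
  have hh := isAnalyticOnDisc_one_sub_mul_padicPow (χ (c : ZMod f))
    (norm_angleBracket_sub_one_le hpc)
  by_cases hχ : χ = 1
  · obtain ⟨g, hg, hgL⟩ := hL.meromorphic
    have hlin := isAnalyticOnDisc_polynomial (p := p) (r := padicLRadius p)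
      (Polynomial.X - Polynomial.C 1)
    -- clearing the denominator `s - 1` makes both sides analytic
    have h := (hlin.mul hI).eqOn_of_eq_one_sub_natCast hR ((hh.mul hg).const_mul (-1))
      (fun m hm => ?_) hs
    · simp only [Polynomial.eval_sub, Polynomial.eval_X, Polynomial.eval_C] at h
      have hs0 : s - 1 ≠ 0 := sub_ne_zero.2 (hs1 hχ)
      rw [hgL s hs (hs1 hχ)]
      field_simp
      linear_combination h
    · have hm0 : (m : ℂ_[p]) ≠ 0 := by exact_mod_cast (by omega : m ≠ 0)
      have h1 := hgL _ (norm_one_sub_natCast_lt p m) (by simpa using hm0)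
      rw [hL.interpolation m hm, neg_eulerBernoulli_div hm, sub_sub_cancel_left, div_neg, neg_div,
        neg_inj, div_left_inj' hm0] at h1
      simp only [Polynomial.eval_sub, Polynomial.eval_X, Polynomial.eval_C]
      rw [hint m hm, padicPow_one_sub_one_sub_natCast, ← h1]
      field_simp
      ring
  · have h := hI.eqOn_of_eq_one_sub_natCast hR ((hh.mul (hL.analytic hχ)).const_mul (-1))
      (fun m hm => ?_) hs
    · rw [h]
      ring
    · rw [hint m hm, padicPow_one_sub_one_sub_natCast, hL.interpolation m hm,
        neg_eulerBernoulli_div hm]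
      ring

end Limit

/-- For `χ = 1` the point `s = 1` is the pole of `L_p(s, 1)`; there the left side, whose singularity
is removable, is read as its limit. -/
theorem mainTheorem3 (p : ℕ) [Fact p.Prime] (f : ℕ) [NeZero f]
    (χ : DirichletCharacter ℂ_[p] f) (hprim : χ.IsPrimitive) (heven : χ.Even)
    (c : ℕ) (hc : 1 < c) (hcop : Nat.Coprime c (p * f)) :
    (∀ s : ℂ_[p], ‖s‖ < padicLRadius p → (χ = 1 → s ≠ 1) →
      Tendsto (fun n : ℕ => padicDirichletSum p χ c (f * p ^ n) s) atTop
        (𝓝 (-(1 - χ (c : ZMod f) * padicPow p (angleBracket p c) (1 - s)) *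
          padicLFunction p χ s))) ∧
    (χ = 1 → ∃ l : ℂ_[p],
      Tendsto (fun s : ℂ_[p] =>
        -(1 - χ (c : ZMod f) * padicPow p (angleBracket p c) (1 - s)) * padicLFunction p χ s)
        (𝓝[≠] 1) (𝓝 l) ∧
      Tendsto (fun n : ℕ => padicDirichletSum p χ c (f * p ^ n) 1) atTop (𝓝 l)) := by
  have hpc : ¬ p ∣ c := (Nat.Prime.coprime_iff_not_dvd Fact.out).1
    (hcop.coprime_dvd_right (dvd_mul_right p f)).symm
  have h1 : ‖(1 : ℂ_[p])‖ < padicLRadius p := by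
    rw [norm_one]
    exact one_lt_padicLRadius p
  obtain ⟨M, hM, hlim, hint⟩ := exists_tendsto_padicDirichletSum hprim (by omega) hcop
  have heq : ∀ s : ℂ_[p], ‖s‖ < padicLRadius p → (χ = 1 → s ≠ 1) → newtonSeries p M (-s) =
      -(1 - χ (c : ZMod f) * padicPow p (angleBracket p c) (1 - s)) * padicLFunction p χ s :=
    fun s hs hs1 => (isPadicLFunction_padicLFunction hprim).newtonSeries_eq hpc hM hint hs hs1
  refine ⟨fun s hs hs1 => heq s hs hs1 ▸ hlim s hs, fun _ => ⟨newtonSeries p M (-1), ?_, hlim 1 h1⟩⟩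
  refine ((tendsto_newtonSeries_neg_one hM).mono_left nhdsWithin_le_nhds).congr' ?_
  filter_upwards [self_mem_nhdsWithin, mem_nhdsWithin_of_mem_nhds
    (continuous_norm.continuousAt.eventually_lt continuousAt_const h1)] with s hs1 hs
  exact heq s hs fun _ => hs1
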